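/- Let $\Omega\subset\mathbb{R}^d$ be non-empty, open and bounded, $T>0$, $\Omega_T:=\Omega\times(0,T)$, $\alpha<0<\beta$ and $\mu>0$. On the Hilbert space $L^2(\Omega_T)$ with inner product $\langle\cdot,\cdot\rangle$ let $$U_{ad}:=\{u\in L^2(\Omega_T) : \alpha\le u\le\beta \text{ a.e.}\},\qquad j_\Omega(f):=\int_\Omega |f(x)|\,dx,\qquad j_2(u):=\Big(\int_0^T j_\Omega(u(\cdot,t))^2\,dt\Big)^{1/2},$$ and $G_2(u):=\mu j_2(u)$ for $u\in U_{ad}$, $G_2(u):=+\infty$ otherwise. Let $j_\Omega'(f;g)$ and $j_2'(u;v)$ denote the (one-sided) directional derivatives and write $u(t)=u(\cdot,t)$. Let $\bar u\in U_{ad}$, and let $F$ be a real-valued function on $U_{ad}$ for which there are $F'(\bar u)\in L^2(\Omega_T)$ and a bounded bilinear form $F''(\bar u)$ on $L^2(\Omega_T)$ such that $$\lim_{k\to\infty}\frac{F(\bar u+t_kv_k)-F(\bar u)-t_k\langle F'(\bar u),v_k\rangle-\tfrac12t_k^2F''(\bar u)(v_k,v_k)}{t_k^2}=0$$ for all sequences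 $t_k>0$, $t_k\to0$, and $v_k\rightharpoonup v$ (weakly in $L^2(\Omega_T)$) with $\bar u+t_kv_k\in U_{ad}$. For $w\in L^2(\Omega_T)$ write $$Q_{t}(v):=\frac{G_2(\bar u+tv)-G_2(\bar u)-t\langle w,v\rangle}{t^2/2},\qquad G_2''(\bar u,w;v):=\inf\Big\{\liminf_{k\to\infty}Q_{t_k}(v_k) : t_k>0,\ t_k\to 0,\ v_k\rightharpoonup v\Big\}\in[-\infty,\infty].$$ $G_2$ is strongly twice epi-differentiable at $\bar u$ for $w$ if for every $v\in L^2(\Omega_T)$ and every sequence $t_k>0$, $t_k\to0$, there are $v_k\to v$ strongly in $L^2(\Omega_T)$ with $Q_{t_k}(v_k)\to G_2''(\bar u,w;v)$. Let $\mathcal{T}_{\bar u}$ be the tangent cone of convex analysis of $U_{ad}$ at $\bar u$, i.e. the closure of $\{v : \bar u+tv\in U_{ad}\text{ for some }t>0\}$, and define the critical cone $$C_{\bar u}:=\{v\in\mathcal{T}_{\bar u} : \langle F'(\bar u),v\rangle+\mu j_2'(\bar u;v)=0\}.$$ **Theorem.** Assume $-F'(\bar u)\in\partial G_2(\bar u)$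 (convex subdifferential). (i) If $\bar u\neq0$, then $$G_2''(\bar u,-F'(\bar u);v)=\frac{\mu}{j_2(\bar u)}\Big(\int_0^T j_\Omega'(\bar u(t);v(t))^2\,dt-j_2'(\bar u;v)^2\Big)\qquad\text{for all } v\in C_{\bar u},$$ and $G_2$ is strongly twice epi-differentiable at $\bar u$ for $-F'(\bar u)$. (ii) If $\bar u=0$, then $G_2''(\bar u,-F'(\bar u);v)\ge0$ for all $v\in C_{\bar u}$, and $G_2''(\bar u,-F'(\bar u);v)=+\infty$ for all $v\in L^2(\Omega_T)\setminus C_{\bar u}$. -/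

import Mathlib

open MeasureTheory Filter Topology Set

namespace SparseControl

noncomputable section

/-! ### Generalized second derivatives on a real Hilbert space

The dual pairing of the Hilbert space with itself is the inner product. -/

section Abstract

variable {H : Type*} [NormedAddCommGroup H] [InnerProductSpace ℝ H]

/-- Weak convergence `v k ⇀ v₀` of a sequence. -/
def WeaklyTendsto (v : ℕ → H) (v₀ : H) : Prop :=
  ∀ φ : H →L[ℝ] ℝ, Tendsto (fun k => φ (v k)) atTop (𝓝 (φ v₀))

/-- `t k ↘ 0`: a sequence of positive numbers which converges to zero. -/
def PosNull (t : ℕ → ℝ) : Prop :=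
  (∀ k, 0 < t k) ∧ Tendsto t atTop (𝓝 0)

/-- The second-order difference quotient
`(G (x + t h) - G x - t ⟨w, h⟩) / (t ^ 2 / 2)` of an extended-real-valued functional. -/
def secondQuotient (G : H → EReal) (x w : H) (t : ℝ) (h : H) : EReal :=
  (G (x + t • h) - G x - ((t * inner ℝ w h : ℝ) : EReal)) / ((t ^ 2 / 2 : ℝ) : EReal)

/-- The weak second subderivative `G''(x, w; h)`. -/
def secondSubderivative (G : H → EReal) (x w h : H) : EReal :=
  sInf {L : EReal | ∃ (t : ℕ → ℝ) (hs : ℕ → H), PosNull t ∧ WeaklyTendsto hs h ∧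
    L = liminf (fun k => secondQuotient G x w (t k) (hs k)) atTop}

/-- Strong twice epi-differentiability of `G` at `x` for `w` (in all directions `h`). -/
def StronglyTwiceEpiDifferentiable (G : H → EReal) (x w : H) : Prop :=
  ∀ h : H, ∀ t : ℕ → ℝ, PosNull t → ∃ hs : ℕ → H, Tendsto hs atTop (𝓝 h) ∧
    Tendsto (fun k => secondQuotient G x w (t k) (hs k)) atTop (𝓝 (secondSubderivative G x w h))

/-- The convex subdifferential `∂G(x)`, for `x` in the domain of `G`. -/
def subdifferential (G : H → EReal) (x : H) : Set H :=
  {w | ∀ y : H, G x + ((inner ℝ w (y - x) : ℝ) : EReal) ≤ G y}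

/-- The tangent cone of convex analysis: the closure of the cone of feasible directions. -/
def tangentCone (K : Set H) (x : H) : Set H :=
  closure {v | ∃ t : ℝ, 0 < t ∧ x + t • v ∈ K}

/-- `F`, of which only the values on `D` matter, has at `x` the first derivative `F₁` and the
second derivative `F₂` in the sense of a Hadamard-type second-order Taylor expansion along all
sequences `x + t k h k ∈ D` with `t k ↘ 0` and `h k` weakly convergent. -/
def HasSecondOrderExpansion (F : H → ℝ) (D : Set H) (x F₁ : H) (F₂ : H →L[ℝ] H →L[ℝ] ℝ) : Prop :=
  ∀ (t : ℕ → ℝ) (hs : ℕ → H) (h : H), PosNull t → WeaklyTendsto hs h →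
    (∀ k, x + t k • hs k ∈ D) →
    Tendsto (fun k => (F (x + t k • hs k) - F x - t k * inner ℝ F₁ (hs k)
      - t k ^ 2 / 2 * F₂ (hs k) (hs k)) / t k ^ 2) atTop (𝓝 0)

end Abstract

/-- The (one-sided) directional derivative `f'(u; v) = lim_{τ ↘ 0} (f (u + τ v) - f u) / τ`. -/
def dirDeriv {V : Type*} [AddCommGroup V] [Module ℝ V] (f : V → ℝ) (u v : V) : ℝ :=
  derivWithin (fun τ : ℝ => f (u + τ • v)) (Ici 0) 0

/-! ### The functionals on the space-time cylinder -/

section Cylinder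

variable {d : ℕ}

/-- Lebesgue measure on `Ω × (0, T)`. -/
abbrev cylinderMeasure (Ω : Set (EuclideanSpace ℝ (Fin d))) (T : ℝ) :
    Measure (EuclideanSpace ℝ (Fin d) × ℝ) :=
  (volume.restrict Ω).prod (volume.restrict (Ioo 0 T))

/-- The Hilbert space `L²(Ω × (0, T))`. -/
abbrev L2Cyl (Ω : Set (EuclideanSpace ℝ (Fin d))) (T : ℝ) : Type :=
  Lp ℝ 2 (cylinderMeasure Ω T)

/-- The time slice `u(t) = u(·, t)`; for almost all `t` it is square integrable on `Ω` and,
up to null sets of `Ω`, independent of the representative of `u`. -/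
def slice {Ω : Set (EuclideanSpace ℝ (Fin d))} {T : ℝ} (u : L2Cyl Ω T) (t : ℝ) :
    EuclideanSpace ℝ (Fin d) → ℝ :=
  fun x => u (x, t)

/-- `j_Ω(f) = ∫_Ω |f| dx`. -/
def jOmega (Ω : Set (EuclideanSpace ℝ (Fin d))) (f : EuclideanSpace ℝ (Fin d) → ℝ) : ℝ :=
  ∫ x in Ω, |f x|

variable {Ω : Set (EuclideanSpace ℝ (Fin d))} {T : ℝ}

/-- `j₂(u) = (∫₀ᵀ j_Ω(u(t))² dt)^(1/2)`. -/
def j2 (u : L2Cyl Ω T) : ℝ :=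
  Real.sqrt (∫ t in Ioo 0 T, jOmega Ω (slice u t) ^ 2)

variable (Ω T) in
/-- The set `U_ad` of feasible controls. -/
def Uad (α β : ℝ) : Set (L2Cyl Ω T) :=
  {u | ∀ᵐ p ∂(cylinderMeasure Ω T), α ≤ u p ∧ u p ≤ β}

open Classical in
/-- `G₂ = δ_{U_ad} + μ j₂`. -/
def G2 (α β μ : ℝ) (u : L2Cyl Ω T) : EReal :=
  if u ∈ Uad Ω T α β then ((μ * j2 u : ℝ) : EReal) else ⊤

/-- The critical cone `C_u` for the multiplier `g = F'(u)`. -/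
def criticalCone (α β μ : ℝ) (u g : L2Cyl Ω T) : Set (L2Cyl Ω T) :=
  {v | v ∈ tangentCone (Uad Ω T α β) u ∧ inner ℝ g v + μ * dirDeriv j2 u v = 0}

/-! ### Well-posedness of the above definitions

The directional derivatives of `j_Ω` and `j₂` exist and the integral of `j_Ω'(u(t); v(t))²` is the
integral of an integrable function. -/

section WellPosed

lemma cauchySchwarz_integral {A : Type*} [MeasurableSpace A] {ν : Measure A} {f g : A → ℝ}
    (hf : MemLp f 2 ν) (hg : MemLp g 2 ν) :
    (∫ a, f a * g a ∂ν) ^ 2 ≤ (∫ a, f a ^ 2 ∂ν) * ∫ a, g a ^ 2 ∂ν := by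
  have h : ∀ c : ℝ, 0 ≤ (∫ a, g a ^ 2 ∂ν) * (c * c) + (-2 * ∫ a, f a * g a ∂ν) * c
      + ∫ a, f a ^ 2 ∂ν := by
    intro c
    have h1 : ∫ a, (f a - c * g a) ^ 2 ∂ν = (∫ a, g a ^ 2 ∂ν) * (c * c)
        + (-2 * ∫ a, f a * g a ∂ν) * c + ∫ a, f a ^ 2 ∂ν := by
      have h2 : (fun a => (f a - c * g a) ^ 2)
          = fun a => (c * c) * g a ^ 2 + (-2 * c) * (f a * g a) + f a ^ 2 := by
        funext a; ring
      have i1 : Integrable (fun a => (c * c) * g a ^ 2) ν := hg.integrable_sq.const_mul _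
      have i2 : Integrable (fun a => (-2 * c) * (f a * g a)) ν :=
        (hf.integrable_mul hg).const_mul _
      have i3 : Integrable (fun a => f a ^ 2) ν := hf.integrable_sq
      have e1 := integral_add (i1.add i2) i3
      have e2 := integral_add i1 i2
      simp only [Pi.add_apply] at e1
      rw [h2, e1, e2, integral_const_mul, integral_const_mul]
      ring
    rw [← h1]
    exact integral_nonneg fun a => sq_nonneg _
  have := discrim_le_zero h
  unfold discrim at this
  nlinarith

lemma convexOn_jOmega {f g : EuclideanSpace ℝ (Fin d) → ℝ}
    (hf : Integrable f (volume.restrict Ω)) (hg : Integrable g (volume.restrict Ω)) :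
    ConvexOn ℝ univ (fun τ : ℝ => jOmega Ω (f + τ • g)) := by
  have hi : ∀ τ : ℝ, Integrable (fun x => |(f + τ • g) x|) (volume.restrict Ω) :=
    fun τ => (hf.add (hg.smul τ)).abs
  refine ⟨convex_univ, fun r _ s _ a b ha hb hab => ?_⟩
  simp only [jOmega, smul_eq_mul]
  rw [← integral_const_mul, ← integral_const_mul, ← integral_add ((hi r).const_mul a)
    ((hi s).const_mul b)]
  refine integral_mono (hi _) (((hi r).const_mul a).add ((hi s).const_mul b)) fun x => ?_
  have : (f + (a * r + b * s) • g) x = a * (f + r • g) x + b * (f + s • g) x := by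
    simp only [Pi.add_apply, Pi.smul_apply, smul_eq_mul]
    linear_combination (-(f x)) * hab
  simp only [this]
  refine (abs_add_le _ _).trans_eq ?_
  rw [abs_mul, abs_mul, abs_of_nonneg ha, abs_of_nonneg hb]

/-- The directional derivative `j_Ω'(f; g)` exists. -/
lemma differentiableWithinAt_jOmega {f g : EuclideanSpace ℝ (Fin d) → ℝ}
    (hf : Integrable f (volume.restrict Ω)) (hg : Integrable g (volume.restrict Ω)) :
    DifferentiableWithinAt ℝ (fun τ : ℝ => jOmega Ω (f + τ • g)) (Ici 0) 0 :=
  differentiableWithinAt_Ioi_iff_Ici.1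
    ((convexOn_jOmega hf hg).differentiableWithinAt_Ioi_of_mem_interior (by simp))

lemma finite_restrict (hΩ : Bornology.IsBounded Ω) : IsFiniteMeasure (volume.restrict Ω) :=
  ⟨by simpa using hΩ.measure_lt_top⟩

/-- Almost every slice is integrable. -/
lemma integrable_slice (hΩ : Bornology.IsBounded Ω) (u : L2Cyl Ω T) :
    ∀ᵐ t ∂(volume.restrict (Ioo 0 T)), Integrable (slice u t) (volume.restrict Ω) := by
  have := finite_restrict hΩ
  exact ((Lp.memLp u).integrable (by norm_num)).prod_left_ae

lemma slice_add_smul (hΩ : Bornology.IsBounded Ω) (u v : L2Cyl Ω T) (τ : ℝ) :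
    ∀ᵐ t ∂(volume.restrict (Ioo 0 T)),
      jOmega Ω (slice (u + τ • v) t) = jOmega Ω (slice u t + τ • slice v t) := by
  have := finite_restrict hΩ
  have h : ∀ᵐ p ∂(cylinderMeasure Ω T), (u + τ • v) p = u p + τ * v p := by
    filter_upwards [Lp.coeFn_add u (τ • v), Lp.coeFn_smul τ v] with p h1 h2
    rw [h1, Pi.add_apply, h2]; rfl
  have h' := Measure.ae_ae_of_ae_prod ((Measure.measurePreserving_swap
    (μ := volume.restrict (Ioo 0 T)) (ν := volume.restrict Ω)).quasiMeasurePreserving.ae h)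
  filter_upwards [h'] with t ht
  refine integral_congr_ae ?_
  filter_upwards [ht] with x hx
  have hx' : (u + τ • v) (x, t) = u (x, t) + τ * v (x, t) := hx
  simp only [slice, Pi.add_apply, Pi.smul_apply, smul_eq_mul]
  rw [hx']

lemma memLp_jOmega (hΩ : Bornology.IsBounded Ω) (u : L2Cyl Ω T) :
    MemLp (fun t => jOmega Ω (slice u t)) 2 (volume.restrict (Ioo 0 T)) := by
  have := finite_restrict hΩ
  have hm : AEStronglyMeasurable (fun t => jOmega Ω (slice u t)) (volume.restrict (Ioo 0 T)) := by
    have h1 : Integrable (fun p => |u p|) (cylinderMeasure Ω T) :=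
      ((Lp.memLp u).integrable (by norm_num)).abs
    exact h1.integral_prod_right.aestronglyMeasurable
  rw [memLp_two_iff_integrable_sq hm]
  have h2 : Integrable (fun p => u p ^ 2) (cylinderMeasure Ω T) := (Lp.memLp u).integrable_sq
  refine (h2.integral_prod_right.const_mul ((volume.restrict Ω).real univ)).mono' (hm.pow 2) ?_
  filter_upwards [integrable_slice hΩ u, h2.prod_left_ae] with t ht1 ht2
  have hL : MemLp (slice u t) 2 (volume.restrict Ω) :=
    (memLp_two_iff_integrable_sq ht1.aestronglyMeasurable).2 ht2
  have := cauchySchwarz_integral (memLp_const (1 : ℝ)) hL.abs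
  simp only [one_mul, one_pow, integral_const, smul_eq_mul, mul_one, Pi.abs_apply, sq_abs] at this
  rw [Real.norm_of_nonneg (sq_nonneg _)]
  exact this

/-- The directional derivative `j₂'(u; v)` exists. -/
lemma differentiableWithinAt_j2 (hΩ : Bornology.IsBounded Ω) (u v : L2Cyl Ω T) :
    DifferentiableWithinAt ℝ (fun τ : ℝ => j2 (u + τ • v)) (Ici 0) 0 := by
  have hc : ConvexOn ℝ univ (fun τ : ℝ => j2 (u + τ • v)) := by
    refine ⟨convex_univ, fun r _ s _ a b ha hb hab => ?_⟩
    have hr := memLp_jOmega hΩ (u + r • v)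
    have hs := memLp_jOmega hΩ (u + s • v)
    have hle : ∀ᵐ t ∂(volume.restrict (Ioo 0 T)),
        jOmega Ω (slice (u + (a • r + b • s) • v) t) ^ 2 ≤
          (a * jOmega Ω (slice (u + r • v) t) + b * jOmega Ω (slice (u + s • v) t)) ^ 2 := by
      filter_upwards [slice_add_smul hΩ u v (a • r + b • s), slice_add_smul hΩ u v r,
        slice_add_smul hΩ u v s, integrable_slice hΩ u, integrable_slice hΩ v]
        with t h1 h2 h3 h4 h5
      rw [h1, h2, h3]
      refine pow_le_pow_left₀ (integral_nonneg fun x => abs_nonneg _) ?_ 2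
      exact (convexOn_jOmega h4 h5).2 (mem_univ r) (mem_univ s) ha hb hab
    have hcs := cauchySchwarz_integral hr hs
    simp only [j2, smul_eq_mul] at hle ⊢
    set P := ∫ t in Ioo 0 T, jOmega Ω (slice (u + r • v) t) ^ 2 with hP
    set Q := ∫ t in Ioo 0 T, jOmega Ω (slice (u + s • v) t) ^ 2 with hQ
    set R := ∫ t in Ioo 0 T, jOmega Ω (slice (u + r • v) t) * jOmega Ω (slice (u + s • v) t)
      with hR
    have hP0 : 0 ≤ P := integral_nonneg fun t => sq_nonneg _
    have hQ0 : 0 ≤ Q := integral_nonneg fun t => sq_nonneg _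
    have i1 := hr.integrable_sq.const_mul (a ^ 2)
    have i2 := hs.integrable_sq.const_mul (b ^ 2)
    have i3 := (hr.integrable_mul hs).const_mul (2 * a * b)
    have hI : ∫ t in Ioo 0 T, (a * jOmega Ω (slice (u + r • v) t)
        + b * jOmega Ω (slice (u + s • v) t)) ^ 2 = a ^ 2 * P + b ^ 2 * Q + 2 * a * b * R := by
      rw [hP, hQ, hR, ← integral_const_mul, ← integral_const_mul, ← integral_const_mul,
        ← integral_add i1 i2]
      erw [← integral_add (i1.add i2) i3]
      refine integral_congr_ae (ae_of_all _ fun t => ?_)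
      simp only [Pi.add_apply, Pi.mul_apply]
      ring
    have hRle : R ≤ √P * √Q := by
      rw [← Real.sqrt_mul hP0]
      exact Real.le_sqrt_of_sq_le hcs
    refine Real.sqrt_le_iff.2 ⟨by positivity, ?_⟩
    refine (integral_mono_ae (memLp_jOmega hΩ _).integrable_sq
      ((hr.const_mul a).add (hs.const_mul b)).integrable_sq hle).trans ?_
    refine hI.le.trans ?_
    have hab' : 0 ≤ 2 * a * b := by positivity
    have e1 := Real.sq_sqrt hP0
    have e2 := Real.sq_sqrt hQ0
    nlinarith [mul_le_mul_of_nonneg_left hRle hab']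
  exact differentiableWithinAt_Ioi_iff_Ici.1
    (hc.differentiableWithinAt_Ioi_of_mem_interior (by simp))

/-- The function `t ↦ j_Ω'(u(t); v(t))²` is integrable. -/
lemma integrable_dirDeriv_sq (hΩ : Bornology.IsBounded Ω) (u v : L2Cyl Ω T) :
    Integrable (fun t => dirDeriv (jOmega Ω) (slice u t) (slice v t) ^ 2)
      (volume.restrict (Ioo 0 T)) := by
  let q : ℕ → ℝ → ℝ := fun n t =>
    ((n : ℝ) + 1) * (jOmega Ω (slice (u + (1 / ((n : ℝ) + 1)) • v) t) - jOmega Ω (slice u t))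
  have hlim : ∀ᵐ t ∂(volume.restrict (Ioo 0 T)), Tendsto (fun n => q n t) atTop
      (𝓝 (dirDeriv (jOmega Ω) (slice u t) (slice v t))) ∧ ∀ n, |q n t| ≤ jOmega Ω (slice v t) := by
    have hall : ∀ᵐ t ∂(volume.restrict (Ioo 0 T)), ∀ n : ℕ,
        jOmega Ω (slice (u + (1 / ((n : ℝ) + 1)) • v) t)
          = jOmega Ω (slice u t + (1 / ((n : ℝ) + 1)) • slice v t) :=
      ae_all_iff.2 fun n => slice_add_smul hΩ u v _
    filter_upwards [hall, integrable_slice hΩ u, integrable_slice hΩ v] with t h1 h2 h3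
    constructor
    · have hd := (differentiableWithinAt_jOmega h2 h3).hasDerivWithinAt
      have hd' := (hasDerivWithinAt_iff_tendsto_slope' (by simp)).1
        (hasDerivWithinAt_Ioi_iff_Ici.2 hd)
      have hs : Tendsto (fun n : ℕ => 1 / ((n : ℝ) + 1)) atTop (𝓝[>] 0) :=
        tendsto_nhdsWithin_iff.2 ⟨tendsto_one_div_add_atTop_nhds_zero_nat,
          Eventually.of_forall fun n => by simp only [mem_Ioi]; positivity⟩
      refine (hd'.comp hs).congr fun n => ?_
      simp only [q, h1, slope_def_field, Function.comp_apply, zero_smul, add_zero, sub_zero]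
      rw [div_div_eq_mul_div, div_one, mul_comm]
    · intro n
      have hn : (0 : ℝ) < (n : ℝ) + 1 := by positivity
      have i1 : Integrable (fun x => |(slice u t + (1 / ((n : ℝ) + 1)) • slice v t) x|)
        (volume.restrict Ω) := (h2.add (h3.smul _)).abs
      simp only [q, h1]
      unfold jOmega
      rw [← integral_sub i1 h2.abs, ← integral_const_mul, ← Real.norm_eq_abs]
      refine (norm_integral_le_of_norm_le h3.abs (ae_of_all _ fun x => ?_))
      rw [norm_mul, Real.norm_of_nonneg hn.le, Real.norm_eq_abs]
      have := abs_abs_sub_abs_le (slice u t x + (1 / ((n : ℝ) + 1)) * slice v t x) (slice u t x)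
      rw [add_sub_cancel_left, abs_mul, abs_of_pos (by positivity : 0 < 1 / ((n : ℝ) + 1))] at this
      calc _ ≤ ((n : ℝ) + 1) * (1 / ((n : ℝ) + 1) * |slice v t x|) :=
            mul_le_mul_of_nonneg_left this hn.le
        _ = |slice v t x| := by field_simp
  have hq : ∀ n, AEStronglyMeasurable (q n) (volume.restrict (Ioo 0 T)) := fun n =>
    ((memLp_jOmega hΩ _).aestronglyMeasurable.sub
      (memLp_jOmega hΩ u).aestronglyMeasurable).const_mul _
  have hm : AEStronglyMeasurable (fun t => dirDeriv (jOmega Ω) (slice u t) (slice v t))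
      (volume.restrict (Ioo 0 T)) :=
    aestronglyMeasurable_of_tendsto_ae atTop hq (hlim.mono fun t h => h.1)
  refine (memLp_jOmega hΩ v).integrable_sq.mono' (hm.pow 2) ?_
  filter_upwards [hlim] with t ht
  rw [Real.norm_of_nonneg (sq_nonneg _), ← sq_abs]
  exact pow_le_pow_left₀ (abs_nonneg _) (le_of_tendsto ht.1.abs (Eventually.of_forall ht.2)) 2

end WellPosed

end Cylinder

end

end SparseControl

open SparseControl

/-!
Write `P f = ∫_Ω f(x, ·) dx` (`spaceIntegral`), a positive bounded operator from `L²(Ω × (0, T))` to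
`L²(0, T)`, and let `d(v)` (`absDirLp`) be the pointwise directional derivative of `|·|` at `u` in
the direction `v`. Then `j₂(u) = ‖P|u|‖`, the function `t ↦ j_Ω'(u(t); v(t))` is `P d(v)`, and for
`u ≠ 0` the chain rule gives `j₂'(u; v) = ⟨P|u|, P d(v)⟩ / j₂(u)`. Here `w = -F'(u)` is a
subgradient, so `⟨w, v⟩ ≤ μ j₂'(u; v)` on the tangent cone and all second-order quotients are
nonnegative.

*Directions outside the critical cone.* If the quotients stay bounded along `h k ⇀ v`, then
`(μ j₂(u + t k h k) - μ j₂(u)) / t k - ⟨w, h k⟩ → 0`. As `j₂'(u; ·)` is convex and continuous, hence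
weakly lower semicontinuous, `v` is critical (`critical_of_bounded`).

*Lower bound for `u ≠ 0`.* Put `a = P|u|`, `s = ‖a‖`, `b k = P((|u + t k h k| - |u|) / t k)` and
`σ k = (j₂(u + t k h k) - s) / t k`. The exact expansion `norm_add_smul_sub_norm` splits the quotient
into `(2 / t k) (μ ⟨a, b k⟩ / s - ⟨w, h k⟩)`, which is nonnegative, and
`(μ / s) (‖b k‖² - (σ k)²)`, where `σ k → j₂'(u; v)`. Boundedness of the quotients forces
`⟨a, b k⟩ → ⟨a, P d(v)⟩`. Since `b k ≥ P d(h k)` and `v ↦ ⟨P d(v), ψ⟩` is weakly lower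
semicontinuous for `ψ ≥ 0`, testing with `ψ = P(d(v) ⊔ (-n|u|)) + n a` and letting `n → ∞` yields
`liminf ‖b k‖² ≥ ‖P d(v)‖²` (`le_of_bounded`).

*Recovery sequence for `u ≠ 0`.* A critical `v` is restricted to the sets on which `u + t k v` is
admissible and `|u + t k v| - |u| = t k d(v)`; they exhaust the cylinder. On disjoint supports
`μ j₂'(u; ·) - w` is additive, and it is nonnegative on the tangent cone, so the restrictions are
critical as well. Hence the first-order part of the quotient vanishes and the rest converges
(`exists_recovery`).
-/

namespace SparseControl

noncomputable section


/-! ### The directional derivative of the absolute value -/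

/-- The one-sided directional derivative of the absolute value at `a` in the direction `b`. -/
def absDir (a b : ℝ) : ℝ := if 0 < a then b else if a < 0 then -b else |b|

lemma absDir_zero_right (a : ℝ) : absDir a 0 = 0 := by simp [absDir]

lemma abs_absDir_sub_le (a b c : ℝ) : |absDir a b - absDir a c| ≤ |b - c| := by
  unfold absDir
  split_ifs
  · exact le_rfl
  · rw [← abs_neg]; exact (congrArg abs (by ring)).le
  · exact abs_abs_sub_abs_le b c

lemma abs_absDir_le (a b : ℝ) : |absDir a b| ≤ |b| := by
  simpa [absDir_zero_right] using abs_absDir_sub_le a b 0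

lemma mul_absDir_le {τ : ℝ} (hτ : 0 ≤ τ) (a b : ℝ) : τ * absDir a b ≤ |a + τ * b| - |a| := by
  unfold absDir
  split_ifs with h1 h2
  · rw [abs_of_pos h1]; linarith [le_abs_self (a + τ * b)]
  · rw [abs_of_neg h2]; linarith [neg_abs_le (a + τ * b)]
  · have : a = 0 := by linarith
    simp [this, abs_mul, abs_of_nonneg hτ]

lemma eventually_abs_add_mul (a b : ℝ) :
    ∀ᶠ τ in 𝓝[>] (0 : ℝ), |a + τ * b| - |a| = τ * absDir a b := by
  have hc : Tendsto (fun τ : ℝ => a + τ * b) (𝓝[>] 0) (𝓝 a) := by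
    have : Tendsto (fun τ : ℝ => a + τ * b) (𝓝 0) (𝓝 (a + 0 * b)) :=
      (by fun_prop : Continuous fun τ : ℝ => a + τ * b).tendsto 0
    simpa using this.mono_left nhdsWithin_le_nhds
  rcases lt_trichotomy a 0 with h | h | h
  · filter_upwards [hc.eventually_lt_const h] with τ hτ
    rw [abs_of_neg hτ, abs_of_neg h, absDir, if_neg h.not_gt, if_pos h]; ring
  · filter_upwards [self_mem_nhdsWithin] with τ hτ
    simp [h, absDir, abs_mul, abs_of_pos (show (0 : ℝ) < τ from hτ)]
  · filter_upwards [hc.eventually_const_lt h] with τ hτ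
    rw [abs_of_pos hτ, abs_of_pos h, absDir, if_pos h]; ring

lemma absDir_convex (c : ℝ) {x y a b : ℝ} (ha : 0 ≤ a) (hb : 0 ≤ b) :
    absDir c (a * x + b * y) ≤ a * absDir c x + b * absDir c y := by
  unfold absDir
  split_ifs
  · exact le_rfl
  · exact (by ring : -(a * x + b * y) = a * -x + b * -y).le
  · refine (abs_add_le _ _).trans_eq ?_
    rw [abs_mul, abs_mul, abs_of_nonneg ha, abs_of_nonneg hb]

lemma measurable_absDir : Measurable fun p : ℝ × ℝ => absDir p.1 p.2 := by
  unfold absDir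
  exact Measurable.ite (measurableSet_lt measurable_const measurable_fst) measurable_snd
    (Measurable.ite (measurableSet_lt measurable_fst measurable_const) measurable_snd.neg
      (by fun_prop))

/-! ### Order and convergence in `L²` -/

section LTwo

variable {A : Type*} [MeasurableSpace A] {ν : Measure A}

lemma L2_norm_sq (f : Lp ℝ 2 ν) : ‖f‖ ^ 2 = ∫ a, f a ^ 2 ∂ν := by
  rw [← real_inner_self_eq_norm_sq, L2.inner_def]
  exact integral_congr_ae (ae_of_all _ fun a => by simp [pow_two])

lemma L2_inner_eq (f g : Lp ℝ 2 ν) : inner ℝ f g = ∫ a, f a * g a ∂ν := by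
  rw [L2.inner_def]
  exact integral_congr_ae (ae_of_all _ fun a => by simp [mul_comm])

lemma L2_inner_nonneg {f g : Lp ℝ 2 ν} (hf : 0 ≤ f) (hg : 0 ≤ g) : 0 ≤ (inner ℝ f g : ℝ) := by
  rw [L2_inner_eq]
  refine integral_nonneg_of_ae ?_
  filter_upwards [(Lp.coeFn_nonneg f).2 hf, (Lp.coeFn_nonneg g).2 hg] with a h1 h2
  exact mul_nonneg h1 h2

lemma L2_inner_le_inner_left {f f' g : Lp ℝ 2 ν} (hf : f ≤ f') (hg : 0 ≤ g) :
    (inner ℝ f g : ℝ) ≤ inner ℝ f' g := by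
  have := L2_inner_nonneg (sub_nonneg.2 hf) hg
  rw [inner_sub_left] at this
  linarith

/-- Dominated convergence in `L²`. -/
lemma L2_tendsto_of_dominated {f : ℕ → Lp ℝ 2 ν} {g b : Lp ℝ 2 ν}
    (hb : ∀ n, ∀ᵐ a ∂ν, |f n a - g a| ≤ b a)
    (hlim : ∀ᵐ a ∂ν, Tendsto (fun n => f n a) atTop (𝓝 (g a))) : Tendsto f atTop (𝓝 g) := by
  have hsub : ∀ n, ∀ᵐ a ∂ν, (f n - g) a = f n a - g a := fun n => Lp.coeFn_sub _ _
  have key : Tendsto (fun n => ∫ a, (f n - g) a ^ 2 ∂ν) atTop (𝓝 (∫ _, (0 : ℝ) ∂ν)) := by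
    refine tendsto_integral_of_dominated_convergence (fun a => b a ^ 2)
      (fun n => (Lp.aestronglyMeasurable _).pow 2) (Lp.memLp b).integrable_sq (fun n => ?_) ?_
    · filter_upwards [hb n, hsub n] with a h1 h2
      rw [h2, Real.norm_of_nonneg (sq_nonneg _), ← sq_abs]
      exact pow_le_pow_left₀ (abs_nonneg _) h1 2
    · filter_upwards [hlim, ae_all_iff.2 hsub] with a h1 h2
      simp only [h2]
      simpa using (h1.sub_const (g a)).pow 2
  rw [tendsto_iff_norm_sub_tendsto_zero]
  simp only [← L2_norm_sq, integral_zero] at key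
  simpa using key.sqrt

lemma coeFn_add_smul (u v : Lp ℝ 2 ν) (τ : ℝ) : ∀ᵐ a ∂ν, (u + τ • v) a = u a + τ * v a := by
  filter_upwards [Lp.coeFn_add u (τ • v), Lp.coeFn_smul τ v] with a h1 h2
  rw [h1, Pi.add_apply, h2]; rfl

lemma memLp_absDir (u v : Lp ℝ 2 ν) : MemLp (fun a => absDir (u a) (v a)) 2 ν := by
  refine (Lp.memLp v).mono ?_ (ae_of_all _ fun a => abs_absDir_le _ _)
  exact (measurable_absDir.comp
    ((Lp.stronglyMeasurable u).measurable.prodMk (Lp.stronglyMeasurable v).measurable)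
    ).aestronglyMeasurable

/-- The directional derivative of `u ↦ |u|` on `L²`, taken pointwise. -/
def absDirLp (u v : Lp ℝ 2 ν) : Lp ℝ 2 ν := (memLp_absDir u v).toLp _

lemma coeFn_absDirLp (u v : Lp ℝ 2 ν) : ∀ᵐ a ∂ν, absDirLp u v a = absDir (u a) (v a) :=
  MemLp.coeFn_toLp _

lemma norm_absDirLp_sub_le (u v v' : Lp ℝ 2 ν) : ‖absDirLp u v - absDirLp u v'‖ ≤ ‖v - v'‖ := by
  refine Lp.norm_le_norm_of_ae_le ?_
  filter_upwards [coeFn_absDirLp u v, coeFn_absDirLp u v',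
    Lp.coeFn_sub (absDirLp u v) (absDirLp u v'), Lp.coeFn_sub v v'] with a h1 h2 h3 h4
  rw [h3, h4, Pi.sub_apply, Pi.sub_apply, h1, h2]
  exact abs_absDir_sub_le _ _ _

lemma continuous_absDirLp (u : Lp ℝ 2 ν) : Continuous (absDirLp u) := by
  refine (LipschitzWith.of_dist_le_mul (K := 1) fun x y => ?_).continuous
  simpa [dist_eq_norm] using norm_absDirLp_sub_le u x y

lemma absDirLp_convex (u x y : Lp ℝ 2 ν) {a b : ℝ} (ha : 0 ≤ a) (hb : 0 ≤ b) :
    absDirLp u (a • x + b • y) ≤ a • absDirLp u x + b • absDirLp u y := by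
  rw [← Lp.coeFn_le]
  filter_upwards [coeFn_absDirLp u (a • x + b • y), coeFn_absDirLp u x, coeFn_absDirLp u y,
    Lp.coeFn_add (a • absDirLp u x) (b • absDirLp u y), Lp.coeFn_smul a (absDirLp u x),
    Lp.coeFn_smul b (absDirLp u y), Lp.coeFn_add (a • x) (b • y), Lp.coeFn_smul a x,
    Lp.coeFn_smul b y] with p h1 h2 h3 h4 h5 h6 h7 h8 h9
  simp only [h1, h2, h3, h4, h5, h6, h7, h8, h9, Pi.add_apply, Pi.smul_apply, smul_eq_mul]
  exact absDir_convex _ ha hb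

/-- The difference quotients of the convex map `u ↦ |u|` lie above its directional derivative. -/
lemma absDirLp_le_slope (u v : Lp ℝ 2 ν) {τ : ℝ} (hτ : 0 < τ) :
    absDirLp u v ≤ τ⁻¹ • (|u + τ • v| - |u|) := by
  rw [← Lp.coeFn_le]
  filter_upwards [coeFn_absDirLp u v, coeFn_add_smul u v τ, Lp.coeFn_abs u,
    Lp.coeFn_abs (u + τ • v), Lp.coeFn_sub |u + τ • v| |u|,
    Lp.coeFn_smul τ⁻¹ (|u + τ • v| - |u|)] with p h1 h2 h3 h4 h5 h6
  simp only [h1, h2, h3, h4, h5, h6, Pi.sub_apply, Pi.smul_apply, smul_eq_mul]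
  rw [le_inv_mul_iff₀ hτ]
  exact mul_absDir_le hτ.le _ _

lemma slope_eq_absDirLp (u v : Lp ℝ 2 ν) {τ : ℝ} (hτ : 0 < τ)
    (h : ∀ᵐ a ∂ν, |u a + τ * v a| - |u a| = τ * absDir (u a) (v a)) :
    τ⁻¹ • (|u + τ • v| - |u|) = absDirLp u v := by
  refine Lp.ext ?_
  filter_upwards [coeFn_absDirLp u v, coeFn_add_smul u v τ, Lp.coeFn_abs u,
    Lp.coeFn_abs (u + τ • v), Lp.coeFn_sub |u + τ • v| |u|,
    Lp.coeFn_smul τ⁻¹ (|u + τ • v| - |u|), h] with p h1 h2 h3 h4 h5 h6 h7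
  simp only [h1, h2, h3, h4, h5, h6, Pi.sub_apply, Pi.smul_apply, smul_eq_mul, h7]
  field_simp

/-- The restriction of `v` to `E`, extended by zero. -/
def cutoff (E : Set A) (hE : MeasurableSet E) (v : Lp ℝ 2 ν) : Lp ℝ 2 ν :=
  ((Lp.memLp v).indicator hE).toLp _

lemma coeFn_cutoff (E : Set A) (hE : MeasurableSet E) (v : Lp ℝ 2 ν) :
    ∀ᵐ a ∂ν, cutoff E hE v a = E.indicator v a :=
  MemLp.coeFn_toLp _

lemma cutoff_add_compl (E : Set A) (hE : MeasurableSet E) (v : Lp ℝ 2 ν) :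
    cutoff E hE v + cutoff Eᶜ hE.compl v = v := by
  refine Lp.ext ?_
  filter_upwards [coeFn_cutoff E hE v, coeFn_cutoff Eᶜ hE.compl v,
    Lp.coeFn_add (cutoff E hE v) (cutoff Eᶜ hE.compl v)] with a h1 h2 h3
  rw [h3, Pi.add_apply, h1, h2]
  exact Set.indicator_self_add_compl_apply E v a

/-- The pointwise directional derivative is additive on directions with disjoint supports. -/
lemma absDirLp_cutoff_add_compl (u : Lp ℝ 2 ν) (E : Set A) (hE : MeasurableSet E) (v : Lp ℝ 2 ν) :
    absDirLp u (cutoff E hE v) + absDirLp u (cutoff Eᶜ hE.compl v) = absDirLp u v := by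
  refine Lp.ext ?_
  filter_upwards [coeFn_cutoff E hE v, coeFn_cutoff Eᶜ hE.compl v,
    Lp.coeFn_add (absDirLp u (cutoff E hE v)) (absDirLp u (cutoff Eᶜ hE.compl v)),
    coeFn_absDirLp u v, coeFn_absDirLp u (cutoff E hE v),
    coeFn_absDirLp u (cutoff Eᶜ hE.compl v)] with a h1 h2 h3 h4 h5 h6
  rw [h3, Pi.add_apply, h4, h5, h6, h1, h2]
  by_cases ha : a ∈ E <;> simp [ha, absDir_zero_right]

lemma continuous_cutoff (E : Set A) (hE : MeasurableSet E) :
    Continuous (cutoff (ν := ν) E hE) := by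
  refine (LipschitzWith.of_dist_le_mul (K := 1) fun x y => ?_).continuous
  rw [dist_eq_norm, dist_eq_norm, NNReal.coe_one, one_mul]
  refine Lp.norm_le_norm_of_ae_le ?_
  filter_upwards [coeFn_cutoff E hE x, coeFn_cutoff E hE y,
    Lp.coeFn_sub (cutoff E hE x) (cutoff E hE y), Lp.coeFn_sub x y] with a h1 h2 h3 h4
  rw [h3, h4, Pi.sub_apply, Pi.sub_apply, h1, h2]
  by_cases ha : a ∈ E <;> simp [ha]

lemma tendsto_slope_abs (u v : Lp ℝ 2 ν) :
    Tendsto (fun τ : ℝ => τ⁻¹ • (|u + τ • v| - |u|)) (𝓝[>] 0) (𝓝 (absDirLp u v)) := by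
  refine tendsto_of_seq_tendsto fun τ hτ => ?_
  have hpos : ∀ᶠ n in atTop, 0 < τ n := hτ.eventually self_mem_nhdsWithin
  obtain ⟨N, hN⟩ := eventually_atTop.1 hpos
  have hsl : ∀ n, ∀ᵐ a ∂ν, ((τ n)⁻¹ • (|u + τ n • v| - |u|)) a
      = (τ n)⁻¹ * (|u a + τ n * v a| - |u a|) := fun n => by
    filter_upwards [coeFn_add_smul u v (τ n), Lp.coeFn_abs u,
      Lp.coeFn_abs (u + τ n • v), Lp.coeFn_sub |u + τ n • v| |u|,
      Lp.coeFn_smul (τ n)⁻¹ (|u + τ n • v| - |u|)] with p h2 h3 h4 h5 h6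
    simp only [h2, h3, h4, h5, h6, Pi.sub_apply, Pi.smul_apply, smul_eq_mul]
  refine (tendsto_add_atTop_iff_nat N).1 (L2_tendsto_of_dominated (b := |v| + |v|) ?_ ?_)
  · intro n
    have hn := hN (n + N) (by omega)
    simp only [Function.comp_apply]
    filter_upwards [hsl (n + N), coeFn_absDirLp u v, Lp.coeFn_abs v, Lp.coeFn_add |v| |v|]
      with a h1 h2 h3 h4
    rw [h1, h2, h4, Pi.add_apply, h3]
    refine (abs_sub _ _).trans (add_le_add ?_ (abs_absDir_le _ _))
    rw [abs_mul, abs_of_pos (inv_pos.2 hn), inv_mul_le_iff₀ hn]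
    refine (abs_abs_sub_abs_le _ _).trans_eq ?_
    rw [add_sub_cancel_left, abs_mul, abs_of_pos hn]
  · filter_upwards [ae_all_iff.2 hsl, coeFn_absDirLp u v] with a h1 h2
    rw [h2]
    simp only [Function.comp_apply, h1]
    refine (tendsto_add_atTop_iff_nat (f := fun n => (τ n)⁻¹ * (|u a + τ n * v a| - |u a|)) N).2 ?_
    refine tendsto_const_nhds.congr' ?_
    filter_upwards [hτ.eventually (eventually_abs_add_mul (u a) (v a)), hpos] with n h3 h4
    simp only [h3]; field_simp

end LTwo

/-! ### Directional derivatives of convex functions and weak lower semicontinuity -/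

section ConvexFunctions

variable {V : Type*} [NormedAddCommGroup V] [NormedSpace ℝ V] {f : V → ℝ}

lemma tendsto_slope_dirDeriv (hf : ConvexOn ℝ univ f) (u v : V) :
    Tendsto (fun τ : ℝ => (f (u + τ • v) - f u) / τ) (𝓝[>] 0) (𝓝 (dirDeriv f u v)) := by
  have hc : ConvexOn ℝ univ (fun τ : ℝ => f (u + τ • v)) := by
    refine ⟨convex_univ, fun r _ s _ a b ha hb hab => ?_⟩
    have := hf.2 (mem_univ (u + r • v)) (mem_univ (u + s • v)) ha hb hab
    refine le_trans (le_of_eq (congrArg f ?_)) this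
    rw [smul_add, smul_add, add_add_add_comm, ← add_smul, hab, one_smul, smul_smul, smul_smul,
      ← add_smul, smul_eq_mul, smul_eq_mul]
  have hd := (differentiableWithinAt_Ioi_iff_Ici.1
    (hc.differentiableWithinAt_Ioi_of_mem_interior (x := 0) (by simp))).hasDerivWithinAt
  have hd' := (hasDerivWithinAt_iff_tendsto_slope' (by simp)).1
    (hasDerivWithinAt_Ioi_iff_Ici.2 hd)
  refine hd'.congr fun τ => ?_
  simp [slope_def_field]

lemma dirDeriv_eq_of_tendsto (hf : ConvexOn ℝ univ f) {u v : V} {L : ℝ}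
    (h : Tendsto (fun τ : ℝ => (f (u + τ • v) - f u) / τ) (𝓝[>] 0) (𝓝 L)) :
    dirDeriv f u v = L :=
  tendsto_nhds_unique (tendsto_slope_dirDeriv hf u v) h

lemma dirDeriv_le_slope (hf : ConvexOn ℝ univ f) (u v : V) {τ : ℝ} (hτ : 0 < τ) :
    dirDeriv f u v ≤ (f (u + τ • v) - f u) / τ := by
  refine le_of_tendsto (tendsto_slope_dirDeriv hf u v) ?_
  filter_upwards [Ioo_mem_nhdsGT hτ] with r hr
  have hr0 : 0 < r := hr.1
  have h := hf.2 (mem_univ u) (mem_univ (u + τ • v)) 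
    (by rw [sub_nonneg, div_le_one hτ]; exact hr.2.le : 0 ≤ 1 - r / τ)
    (by positivity : 0 ≤ r / τ) (by ring)
  have e : (1 - r / τ) • u + (r / τ) • (u + τ • v) = u + r • v := by
    rw [smul_add, smul_smul, ← add_assoc, ← add_smul, div_mul_cancel₀ _ hτ.ne']
    simp
  rw [e, smul_eq_mul, smul_eq_mul] at h
  rw [div_le_div_iff₀ hr0 hτ]
  have e2 : r / τ * τ = r := div_mul_cancel₀ _ hτ.ne'
  have h' := mul_le_mul_of_nonneg_right h hτ.le
  have e3 : ((1 - r / τ) * f u + r / τ * f (u + τ • v)) * τ = (τ - r) * f u + r * f (u + τ • v) := by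
    linear_combination (f (u + τ • v) - f u) * e2
  rw [e3] at h'
  linarith

lemma convexOn_dirDeriv (hf : ConvexOn ℝ univ f) (u : V) : ConvexOn ℝ univ (dirDeriv f u) := by
  refine ⟨convex_univ, fun x _ y _ a b ha hb hab => ?_⟩
  refine le_of_tendsto_of_tendsto (tendsto_slope_dirDeriv hf u _)
    (((tendsto_slope_dirDeriv hf u x).const_mul a).add
      ((tendsto_slope_dirDeriv hf u y).const_mul b)) ?_
  filter_upwards [self_mem_nhdsWithin] with τ hτ
  have hτ : 0 < τ := hτ
  have h := hf.2 (mem_univ (u + τ • x)) (mem_univ (u + τ • y)) ha hb hab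
  have e : a • (u + τ • x) + b • (u + τ • y) = u + τ • (a • x + b • y) := by
    rw [smul_add, smul_add, add_add_add_comm, ← add_smul, hab, one_smul, smul_add,
      smul_comm a τ, smul_comm b τ]
  rw [e, smul_eq_mul, smul_eq_mul] at h
  have hfu : f u = a * f u + b * f u := by rw [← add_mul, hab, one_mul]
  rw [← mul_div_assoc, ← mul_div_assoc, ← add_div]
  gcongr
  linarith

lemma abs_dirDeriv_sub_le (hf : ConvexOn ℝ univ f) {C : ℝ}
    (hL : ∀ x y, |f x - f y| ≤ C * ‖x - y‖) (u x y : V) :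
    |dirDeriv f u x - dirDeriv f u y| ≤ C * ‖x - y‖ := by
  refine le_of_tendsto ((tendsto_slope_dirDeriv hf u x).sub (tendsto_slope_dirDeriv hf u y)).abs ?_
  filter_upwards [self_mem_nhdsWithin] with τ hτ
  have hτ : 0 < τ := hτ
  rw [← sub_div, sub_sub_sub_cancel_right, abs_div, abs_of_pos hτ, div_le_iff₀ hτ]
  refine (hL _ _).trans_eq ?_
  rw [add_sub_add_left_eq_sub, ← smul_sub, norm_smul, Real.norm_of_nonneg hτ.le]
  ring

lemma continuous_dirDeriv (hf : ConvexOn ℝ univ f) {C : ℝ}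
    (hL : ∀ x y, |f x - f y| ≤ C * ‖x - y‖) (u : V) : Continuous (dirDeriv f u) := by
  refine (LipschitzWith.of_dist_le_mul (K := C.toNNReal) fun x y => ?_).continuous
  rw [Real.dist_eq, dist_eq_norm, Real.coe_toNNReal']
  exact (abs_dirDeriv_sub_le hf hL u x y).trans
    (mul_le_mul_of_nonneg_right (le_max_left _ _) (norm_nonneg _))

end ConvexFunctions

section WeakConvergence

variable {H : Type*} [NormedAddCommGroup H] [InnerProductSpace ℝ H]

lemma WeaklyTendsto.of_tendsto {v : ℕ → H} {v₀ : H} (h : Tendsto v atTop (𝓝 v₀)) :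
    WeaklyTendsto v v₀ := fun φ => (φ.continuous.tendsto v₀).comp h

lemma WeaklyTendsto.comp {v : ℕ → H} {v₀ : H} (h : WeaklyTendsto v v₀) {φ : ℕ → ℕ}
    (hφ : Tendsto φ atTop atTop) : WeaklyTendsto (v ∘ φ) v₀ := fun g => (h g).comp hφ

lemma WeaklyTendsto.inner {v : ℕ → H} {v₀ : H} (h : WeaklyTendsto v v₀) (w : H) :
    Tendsto (fun k => (inner ℝ w (v k) : ℝ)) atTop (𝓝 (inner ℝ w v₀)) := h (innerSL ℝ w)

/-- Closed convex sets are weakly sequentially closed. -/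
lemma WeaklyTendsto.mem_of_isClosed {v : ℕ → H} {v₀ : H} (h : WeaklyTendsto v v₀) {K : Set H}
    (hK : Convex ℝ K) (hKc : IsClosed K) (hv : ∀ᶠ k in atTop, v k ∈ K) : v₀ ∈ K := by
  by_contra hn
  obtain ⟨φ, r, h1, h2⟩ := geometric_hahn_banach_closed_point hK hKc hn
  exact h2.not_ge (le_of_tendsto (h φ) (hv.mono fun _ hk => (h1 _ hk).le))

/-- Continuous convex functions are weakly sequentially lower semicontinuous. -/
lemma WeaklyTendsto.le_of_convexOn {v : ℕ → H} {v₀ : H} (h : WeaklyTendsto v v₀) {f : H → ℝ}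
    (hf : ConvexOn ℝ univ f) (hfc : Continuous f) {r : ℕ → ℝ} {r₀ : ℝ}
    (hr : Tendsto r atTop (𝓝 r₀)) (hv : ∀ k, f (v k) ≤ r k) : f v₀ ≤ r₀ := by
  refine le_of_forall_gt_imp_ge_of_dense fun c hc => ?_
  have hK : Convex ℝ {x | f x ≤ c} := by simpa using hf.convex_le c
  exact h.mem_of_isClosed hK (isClosed_le hfc continuous_const)
    ((hr.eventually_lt_const hc).mono fun k hk => (hv k).trans hk.le)

lemma PosNull.tendsto_nhdsGT {t : ℕ → ℝ} (ht : PosNull t) : Tendsto t atTop (𝓝[>] 0) :=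
  tendsto_nhdsWithin_iff.2 ⟨ht.2, Eventually.of_forall ht.1⟩

lemma PosNull.comp {t : ℕ → ℝ} (ht : PosNull t) {φ : ℕ → ℕ} (hφ : Tendsto φ atTop atTop) :
    PosNull (t ∘ φ) := ⟨fun _ => ht.1 _, ht.2.comp hφ⟩

lemma add_smul_mem_of_le {K : Set H} (hK : Convex ℝ K) {x v : H} (hx : x ∈ K) {t s : ℝ}
    (hs : 0 < s) (hst : s ≤ t) (hv : x + t • v ∈ K) : x + s • v ∈ K := by
  have ht : 0 < t := hs.trans_le hst
  have := hK.add_smul_mem hx hv (t := s / t) ⟨by positivity, (div_le_one ht).2 hst⟩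
  rwa [smul_smul, div_mul_cancel₀ _ ht.ne'] at this

lemma convex_tangentCone {K : Set H} (hK : Convex ℝ K) {x : H} (hx : x ∈ K) :
    Convex ℝ (tangentCone K x) := by
  refine Convex.closure ?_
  rintro v ⟨t, ht, hv⟩ v' ⟨t', ht', hv'⟩ a b ha hb hab
  refine ⟨min t t', lt_min ht ht', ?_⟩
  have := hK (add_smul_mem_of_le hK hx (lt_min ht ht') (min_le_left t t') hv)
    (add_smul_mem_of_le hK hx (lt_min ht ht') (min_le_right t t') hv') ha hb hab
  rw [smul_add, smul_add, add_add_add_comm, ← add_smul, hab, one_smul,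
    smul_comm a, smul_comm b, ← smul_add] at this
  exact this

end WeakConvergence


/-! ### Integration over the space variable -/

section SpaceIntegral

variable {d : ℕ} {Ω : Set (EuclideanSpace ℝ (Fin d))} {T : ℝ}

lemma ae_ae_slice {p : EuclideanSpace ℝ (Fin d) × ℝ → Prop}
    (h : ∀ᵐ z ∂(cylinderMeasure Ω T), p z) :
    ∀ᵐ t ∂(volume.restrict (Ioo 0 T)), ∀ᵐ x ∂(volume.restrict Ω), p (x, t) :=
  Measure.ae_ae_of_ae_prod ((Measure.measurePreserving_swap
    (μ := volume.restrict (Ioo 0 T)) (ν := volume.restrict Ω)).quasiMeasurePreserving.ae h)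

lemma memLp_spaceIntegral (hΩ : Bornology.IsBounded Ω) (u : L2Cyl Ω T) :
    MemLp (fun t => ∫ x in Ω, u (x, t)) 2 (volume.restrict (Ioo 0 T)) := by
  have := finite_restrict hΩ
  have h1 : Integrable u (cylinderMeasure Ω T) := (Lp.memLp u).integrable (by norm_num)
  refine (memLp_jOmega hΩ u).mono h1.integral_prod_right.aestronglyMeasurable
    (ae_of_all _ fun t => ?_)
  rw [Real.norm_eq_abs, Real.norm_eq_abs]
  exact abs_integral_le_integral_abs.trans (le_abs_self _)

lemma integral_sq_spaceIntegral_le (hΩ : Bornology.IsBounded Ω) (u : L2Cyl Ω T) :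
    ∫ t in Ioo 0 T, (∫ x in Ω, u (x, t)) ^ 2
      ≤ (volume.restrict Ω).real univ * ‖u‖ ^ 2 := by
  have := finite_restrict hΩ
  have h2 : Integrable (fun p => u p ^ 2) (cylinderMeasure Ω T) := (Lp.memLp u).integrable_sq
  rw [L2_norm_sq, integral_prod_symm _ h2, ← integral_const_mul]
  refine integral_mono_ae (memLp_spaceIntegral hΩ u).integrable_sq
    (h2.integral_prod_right.const_mul _) ?_
  filter_upwards [integrable_slice hΩ u, h2.prod_left_ae] with t ht1 ht2
  have hL : MemLp (slice u t) 2 (volume.restrict Ω) :=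
    (memLp_two_iff_integrable_sq ht1.aestronglyMeasurable).2 ht2
  have := cauchySchwarz_integral (memLp_const (1 : ℝ)) hL
  simp only [one_mul, one_pow, integral_const, smul_eq_mul, mul_one] at this
  exact this

/-- The operator `u ↦ ∫_Ω u(x, ·) dx` from `L²(Ω × (0, T))` to `L²(0, T)`. -/
def spaceIntegral (hΩ : Bornology.IsBounded Ω) :
    L2Cyl Ω T →L[ℝ] Lp ℝ 2 (volume.restrict (Ioo 0 T)) :=
  LinearMap.mkContinuous
    { toFun := fun u => (memLp_spaceIntegral hΩ u).toLp _
      map_add' := fun u v => by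
        rw [← MemLp.toLp_add]
        refine MemLp.toLp_congr _ _ ?_
        filter_upwards [integrable_slice hΩ u, integrable_slice hΩ v,
          ae_ae_slice (Lp.coeFn_add u v)] with t h1 h2 h3
        rw [Pi.add_apply, integral_congr_ae h3]
        exact integral_add h1 h2
      map_smul' := fun c u => by
        rw [RingHom.id_apply, ← MemLp.toLp_const_smul]
        refine MemLp.toLp_congr _ _ ?_
        filter_upwards [ae_ae_slice (Lp.coeFn_smul c u)] with t h3
        rw [Pi.smul_apply, integral_congr_ae h3]
        exact integral_const_mul c _ }
    (Real.sqrt ((volume.restrict Ω).real univ)) (fun u => by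
      refine le_of_sq_le_sq ?_ (by positivity)
      rw [mul_pow, Real.sq_sqrt measureReal_nonneg, L2_norm_sq]
      refine le_trans (le_of_eq (integral_congr_ae ?_)) (integral_sq_spaceIntegral_le hΩ u)
      filter_upwards [MemLp.coeFn_toLp (memLp_spaceIntegral hΩ u)] with t ht
      exact congrArg (· ^ 2) ht)

lemma coeFn_spaceIntegral (hΩ : Bornology.IsBounded Ω) (u : L2Cyl Ω T) :
    ∀ᵐ t ∂(volume.restrict (Ioo 0 T)), spaceIntegral hΩ u t = ∫ x in Ω, u (x, t) :=
  MemLp.coeFn_toLp (memLp_spaceIntegral hΩ u)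

lemma spaceIntegral_nonneg (hΩ : Bornology.IsBounded Ω) {u : L2Cyl Ω T} (hu : 0 ≤ u) :
    0 ≤ spaceIntegral hΩ u := by
  rw [← Lp.coeFn_nonneg]
  filter_upwards [coeFn_spaceIntegral hΩ u, ae_ae_slice ((Lp.coeFn_nonneg u).2 hu)] with t h1 h2
  rw [h1]
  exact integral_nonneg_of_ae h2

lemma spaceIntegral_mono (hΩ : Bornology.IsBounded Ω) {u v : L2Cyl Ω T} (h : u ≤ v) :
    spaceIntegral hΩ u ≤ spaceIntegral hΩ v := by
  have := spaceIntegral_nonneg hΩ (sub_nonneg.2 h)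
  rwa [map_sub, sub_nonneg] at this

lemma coeFn_spaceIntegral_abs (hΩ : Bornology.IsBounded Ω) (u : L2Cyl Ω T) :
    ∀ᵐ t ∂(volume.restrict (Ioo 0 T)), spaceIntegral hΩ |u| t = jOmega Ω (slice u t) := by
  filter_upwards [coeFn_spaceIntegral hΩ |u|, ae_ae_slice (Lp.coeFn_abs u)] with t h1 h2
  rw [h1]
  exact integral_congr_ae h2

lemma j2_eq_norm (hΩ : Bornology.IsBounded Ω) (u : L2Cyl Ω T) :
    j2 u = ‖spaceIntegral hΩ |u|‖ := by
  rw [j2, Real.sqrt_eq_iff_mul_self_eq (integral_nonneg fun _ => sq_nonneg _) (norm_nonneg _),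
    ← pow_two, L2_norm_sq]
  refine integral_congr_ae ?_
  filter_upwards [coeFn_spaceIntegral_abs hΩ u] with t h
  rw [h]

lemma j2_pos (hΩ : Bornology.IsBounded Ω) {u : L2Cyl Ω T} (hu : u ≠ 0) : 0 < j2 u := by
  rw [j2_eq_norm hΩ]
  refine norm_pos_iff.2 fun h0 => hu ?_
  have := finite_restrict hΩ
  have h1 : Integrable (fun p => |u p|) (cylinderMeasure Ω T) :=
    ((Lp.memLp u).integrable (by norm_num)).abs
  have h2 : ∫ p, |u p| ∂(cylinderMeasure Ω T) = 0 := by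
    rw [integral_prod_symm _ h1]
    refine integral_eq_zero_of_ae ?_
    have h3 := Lp.coeFn_zero ℝ 2 (volume.restrict (Ioo 0 T))
    rw [← h0] at h3
    filter_upwards [h3, coeFn_spaceIntegral_abs hΩ u] with t h4 h5
    exact h5.symm.trans h4
  rw [integral_eq_zero_iff_of_nonneg (fun _ => abs_nonneg _) h1] at h2
  refine (Lp.eq_zero_iff_ae_eq_zero).2 ?_
  filter_upwards [h2] with p hp
  exact abs_eq_zero.1 hp

lemma convexOn_j2 (hΩ : Bornology.IsBounded Ω) :
    ConvexOn ℝ univ (j2 : L2Cyl Ω T → ℝ) := by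
  refine ⟨convex_univ, fun x _ y _ a b ha hb _ => ?_⟩
  simp only [j2_eq_norm hΩ]
  have h1 : |a • x + b • y| ≤ a • |x| + b • |y| := by
    rw [← Lp.coeFn_le]
    filter_upwards [Lp.coeFn_abs (a • x + b • y), Lp.coeFn_add (a • |x|) (b • |y|),
      Lp.coeFn_smul a |x|, Lp.coeFn_smul b |y|, Lp.coeFn_abs x, Lp.coeFn_abs y,
      Lp.coeFn_add (a • x) (b • y), Lp.coeFn_smul a x, Lp.coeFn_smul b y]
      with p h1 h2 h3 h4 h5 h6 h7 h8 h9
    simp only [h1, h2, h3, h4, h5, h6, h7, h8, h9, Pi.add_apply, Pi.smul_apply, smul_eq_mul]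
    refine (abs_add_le _ _).trans_eq ?_
    rw [abs_mul, abs_mul, abs_of_nonneg ha, abs_of_nonneg hb]
  have h2 := spaceIntegral_mono hΩ h1
  have h3 := spaceIntegral_nonneg hΩ (abs_nonneg (a • x + b • y))
  have h4 : ‖spaceIntegral hΩ |a • x + b • y|‖ ≤ ‖spaceIntegral hΩ (a • |x| + b • |y|)‖ := by
    refine norm_le_norm_of_abs_le_abs ?_
    rw [abs_of_nonneg h3, abs_of_nonneg (h3.trans h2)]
    exact h2
  refine h4.trans ?_
  rw [map_add, map_smul, map_smul]
  refine (norm_add_le _ _).trans_eq ?_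
  rw [norm_smul, norm_smul, Real.norm_of_nonneg ha, Real.norm_of_nonneg hb]
  rfl

lemma abs_j2_sub_le (hΩ : Bornology.IsBounded Ω) (x y : L2Cyl Ω T) :
    |j2 x - j2 y| ≤ ‖spaceIntegral (T := T) hΩ‖ * ‖x - y‖ := by
  rw [j2_eq_norm hΩ, j2_eq_norm hΩ]
  refine (abs_norm_sub_norm_le _ _).trans ?_
  rw [← map_sub]
  exact ((spaceIntegral hΩ).le_opNorm _).trans
    (mul_le_mul_of_nonneg_left (norm_abs_sub_abs x y) (norm_nonneg _))

/-- The directional derivative of `j_Ω` is the integral of the pointwise one. -/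
lemma dirDeriv_jOmega {f g : EuclideanSpace ℝ (Fin d) → ℝ}
    (hf : Integrable f (volume.restrict Ω)) (hg : Integrable g (volume.restrict Ω)) :
    dirDeriv (jOmega Ω) f g = ∫ x in Ω, absDir (f x) (g x) := by
  have hd := (differentiableWithinAt_jOmega hf hg).hasDerivWithinAt
  have hd' := (hasDerivWithinAt_iff_tendsto_slope' (by simp)).1
    (hasDerivWithinAt_Ioi_iff_Ici.2 hd)
  refine tendsto_nhds_unique hd' ?_
  have hi : ∀ τ : ℝ, Integrable (fun x => |f x + τ * g x|) (volume.restrict Ω) :=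
    fun τ => (hf.add (hg.smul τ)).abs
  have key : Tendsto (fun τ : ℝ => ∫ x in Ω, (|f x + τ * g x| - |f x|) / τ) (𝓝[>] 0)
      (𝓝 (∫ x in Ω, absDir (f x) (g x))) := by
    refine tendsto_integral_filter_of_dominated_convergence (fun x => |g x|)
      (Eventually.of_forall fun τ => (((hi τ).sub hf.abs).div_const τ).aestronglyMeasurable)
      ?_ hg.abs (ae_of_all _ fun x => ?_)
    · filter_upwards [self_mem_nhdsWithin] with τ hτ
      have hτ : 0 < τ := hτ
      refine ae_of_all _ fun x => ?_
      rw [Real.norm_eq_abs, abs_div, abs_of_pos hτ, div_le_iff₀ hτ]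
      refine (abs_abs_sub_abs_le _ _).trans_eq ?_
      rw [add_sub_cancel_left, abs_mul, abs_of_pos hτ, mul_comm]
    · refine tendsto_const_nhds.congr' ?_
      filter_upwards [eventually_abs_add_mul (f x) (g x), self_mem_nhdsWithin] with τ h1 h2
      have h2 : 0 < τ := h2
      rw [h1]; field_simp
  refine key.congr fun τ => ?_
  rw [slope_def_field, integral_div, integral_sub (hi τ) hf.abs]
  simp [jOmega]

lemma integral_dirDeriv_sq (hΩ : Bornology.IsBounded Ω) (u v : L2Cyl Ω T) :
    ∫ t in Ioo 0 T, dirDeriv (jOmega Ω) (slice u t) (slice v t) ^ 2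
      = ‖spaceIntegral hΩ (absDirLp u v)‖ ^ 2 := by
  rw [L2_norm_sq]
  refine integral_congr_ae ?_
  filter_upwards [coeFn_spaceIntegral hΩ (absDirLp u v), ae_ae_slice (coeFn_absDirLp u v),
    integrable_slice hΩ u, integrable_slice hΩ v] with t h1 h2 h3 h4
  rw [h1, integral_congr_ae h2, dirDeriv_jOmega h3 h4]
  rfl

/-- The chain rule for `j₂ = ‖∫_Ω |u| dx‖` away from the origin. -/
lemma dirDeriv_j2 (hΩ : Bornology.IsBounded Ω) {u : L2Cyl Ω T} (hu : u ≠ 0) (v : L2Cyl Ω T) :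
    dirDeriv j2 u v
      = inner ℝ (spaceIntegral hΩ |u|) (spaceIntegral hΩ (absDirLp u v)) / j2 u := by
  have hs := j2_pos hΩ hu
  refine dirDeriv_eq_of_tendsto (convexOn_j2 hΩ) ?_
  set P := spaceIntegral (T := T) hΩ with hP
  set q : ℝ → L2Cyl Ω T := fun τ => τ⁻¹ • (|u + τ • v| - |u|) with hq
  have hqt : Tendsto (fun τ => P (q τ)) (𝓝[>] 0) (𝓝 (P (absDirLp u v))) :=
    (P.continuous.tendsto _).comp (tendsto_slope_abs u v)
  have h0 : Tendsto (fun τ : ℝ => τ) (𝓝[>] 0) (𝓝 0) := nhdsWithin_le_nhds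
  have hj : Tendsto (fun τ : ℝ => ‖P |u| + τ • P (q τ)‖) (𝓝[>] 0) (𝓝 (j2 u)) := by
    rw [j2_eq_norm hΩ]
    simpa using (tendsto_const_nhds.add (h0.smul hqt)).norm
  have hlim : Tendsto (fun τ : ℝ => (2 * inner ℝ (P |u|) (P (q τ)) + τ * ‖P (q τ)‖ ^ 2)
      / (‖P |u| + τ • P (q τ)‖ + j2 u)) (𝓝[>] 0)
      (𝓝 ((2 * inner ℝ (P |u|) (P (absDirLp u v)) + 0 * ‖P (absDirLp u v)‖ ^ 2)
        / (j2 u + j2 u))) :=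
    (((tendsto_const_nhds.inner hqt).const_mul 2).add (h0.mul (hqt.norm.pow 2))).div
      (hj.add_const _) (by positivity)
  have e : (2 * inner ℝ (P |u|) (P (absDirLp u v)) + 0 * ‖P (absDirLp u v)‖ ^ 2)
      / (j2 u + j2 u) = inner ℝ (P |u|) (P (absDirLp u v)) / j2 u := by
    field_simp; ring
  rw [e] at hlim
  refine hlim.congr' ?_
  filter_upwards [self_mem_nhdsWithin] with τ hτ
  have hτ : 0 < τ := hτ
  have h1 : P |u| + τ • P (q τ) = P |u + τ • v| := by
    rw [hq, ← map_smul, smul_smul, mul_inv_cancel₀ hτ.ne', one_smul, map_sub]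
    abel
  have h2 : ‖P |u| + τ • P (q τ)‖ ^ 2
      = j2 u ^ 2 + 2 * τ * inner ℝ (P |u|) (P (q τ)) + τ ^ 2 * ‖P (q τ)‖ ^ 2 := by
    rw [norm_add_sq_real, inner_smul_right, norm_smul, mul_pow, Real.norm_of_nonneg hτ.le,
      j2_eq_norm hΩ]
    ring
  rw [j2_eq_norm hΩ (u + τ • v), ← h1]
  rw [div_eq_div_iff (by positivity) hτ.ne']
  linear_combination -h2

end SpaceIntegral


/-! ### Feasible directions and the critical cone -/

section Feasible

variable {d : ℕ} {Ω : Set (EuclideanSpace ℝ (Fin d))} {T α β μ : ℝ} {u w : L2Cyl Ω T}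

lemma mem_Uad_add_smul {v : L2Cyl Ω T} {t : ℝ} : u + t • v ∈ Uad Ω T α β ↔
    ∀ᵐ p ∂(cylinderMeasure Ω T), α ≤ u p + t * v p ∧ u p + t * v p ≤ β := by
  change (∀ᵐ p ∂(cylinderMeasure Ω T), α ≤ (u + t • v) p ∧ (u + t • v) p ≤ β) ↔ _
  refine eventually_congr ?_
  filter_upwards [coeFn_add_smul u v t] with p hp
  rw [hp]

lemma convex_Uad : Convex ℝ (Uad Ω T α β) := by
  intro x hx y hy a b ha hb hab
  filter_upwards [hx, hy, Lp.coeFn_add (a • x) (b • y), Lp.coeFn_smul a x, Lp.coeFn_smul b y]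
    with p h1 h2 h3 h4 h5
  rw [h3, Pi.add_apply, h4, h5]
  exact convex_Icc α β h1 h2 ha hb hab

lemma mem_tangentCone_of_mem {v : L2Cyl Ω T} {t : ℝ} (ht : 0 < t)
    (h : u + t • v ∈ Uad Ω T α β) : v ∈ tangentCone (Uad Ω T α β) u :=
  subset_closure ⟨t, ht, h⟩

lemma cutoff_mem_tangentCone (hu : u ∈ Uad Ω T α β)
    (E : Set (EuclideanSpace ℝ (Fin d) × ℝ)) (hE : MeasurableSet E) {v : L2Cyl Ω T}
    (hv : v ∈ tangentCone (Uad Ω T α β) u) : cutoff E hE v ∈ tangentCone (Uad Ω T α β) u := by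
  refine map_mem_closure (continuous_cutoff E hE) hv fun y hy => ?_
  obtain ⟨t, ht, hy⟩ := hy
  refine ⟨t, ht, mem_Uad_add_smul.2 ?_⟩
  filter_upwards [hu, mem_Uad_add_smul.1 hy, coeFn_cutoff E hE y] with p h1 h2 h3
  rw [h3]
  by_cases hp : p ∈ E
  · simpa [hp] using h2
  · simpa [hp] using h1

/-- Tangent directions point into the interval `[α, β]` wherever `u` attains a bound. -/
lemma sign_of_mem_tangentCone {v : L2Cyl Ω T}
    (hv : v ∈ tangentCone (Uad Ω T α β) u) :
    ∀ᵐ p ∂(cylinderMeasure Ω T), (u p = α → 0 ≤ v p) ∧ (u p = β → v p ≤ 0) := by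
  obtain ⟨y, hy, hyv⟩ := mem_closure_iff_seq_limit.1 hv
  obtain ⟨φ, -, hφ⟩ := (tendstoInMeasure_of_tendsto_Lp hyv).exists_seq_tendsto_ae
  have hy' : ∀ n, ∀ᵐ p ∂(cylinderMeasure Ω T), (u p = α → 0 ≤ y n p) ∧ (u p = β → y n p ≤ 0) := by
    intro n
    obtain ⟨t, ht, hm⟩ := hy n
    filter_upwards [mem_Uad_add_smul.1 hm] with p hp
    refine ⟨fun h => ?_, fun h => ?_⟩
    · have := hp.1
      rw [h] at this
      exact nonneg_of_mul_nonneg_right (by linarith) ht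
    · have := hp.2
      rw [h] at this
      exact nonpos_of_mul_nonpos_right (by linarith) ht
  filter_upwards [ae_all_iff.2 hy', hφ] with p h1 h2
  exact ⟨fun h => ge_of_tendsto h2 (Eventually.of_forall fun n => (h1 (φ n)).1 h),
    fun h => le_of_tendsto h2 (Eventually.of_forall fun n => (h1 (φ n)).2 h)⟩

lemma le_of_mem_subdifferential (hu : u ∈ Uad Ω T α β) (hw : w ∈ subdifferential (G2 α β μ) u)
    {v : L2Cyl Ω T} {t : ℝ} (h : u + t • v ∈ Uad Ω T α β) :
    t * inner ℝ w v ≤ μ * j2 (u + t • v) - μ * j2 u := by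
  have := hw (u + t • v)
  rw [G2, G2, if_pos hu, if_pos h, add_sub_cancel_left, inner_smul_right, ← EReal.coe_add,
    EReal.coe_le_coe_iff] at this
  linarith

/-- First-order optimality: `w - μ j₂'(u; ·)` is nonpositive on the tangent cone. -/
lemma inner_le_dirDeriv (hΩ : Bornology.IsBounded Ω) (hu : u ∈ Uad Ω T α β)
    (hw : w ∈ subdifferential (G2 α β μ) u) {v : L2Cyl Ω T}
    (hv : v ∈ tangentCone (Uad Ω T α β) u) : inner ℝ w v ≤ μ * dirDeriv j2 u v := by
  refine closure_minimal (t := {v | (inner ℝ w v : ℝ) ≤ μ * dirDeriv j2 u v}) ?_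
    (isClosed_le (by fun_prop)
      ((continuous_dirDeriv (convexOn_j2 hΩ) (abs_j2_sub_le hΩ) u).const_mul μ)) hv
  rintro y ⟨t, ht, hy⟩
  refine ge_of_tendsto ((tendsto_slope_dirDeriv (convexOn_j2 hΩ) u y).const_mul μ) ?_
  filter_upwards [Ioo_mem_nhdsGT ht] with s hs
  have hs0 : 0 < s := hs.1
  have hmem : u + s • y ∈ Uad Ω T α β := add_smul_mem_of_le convex_Uad hu hs0 hs.2.le hy
  have := le_of_mem_subdifferential hu hw hmem
  rw [← mul_div_assoc, le_div_iff₀ hs0]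
  linarith

lemma secondQuotient_of_mem (hu : u ∈ Uad Ω T α β) {v : L2Cyl Ω T} {t : ℝ}
    (h : u + t • v ∈ Uad Ω T α β) : secondQuotient (G2 α β μ) u w t v
      = (((μ * j2 (u + t • v) - μ * j2 u - t * inner ℝ w v) / (t ^ 2 / 2) : ℝ) : EReal) := by
  rw [secondQuotient, G2, G2, if_pos hu, if_pos h, ← EReal.coe_sub, ← EReal.coe_sub,
    ← EReal.coe_div]

lemma secondQuotient_of_notMem (hu : u ∈ Uad Ω T α β) {v : L2Cyl Ω T} {t : ℝ} (ht : 0 < t)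
    (h : u + t • v ∉ Uad Ω T α β) : secondQuotient (G2 α β μ) u w t v = ⊤ := by
  rw [secondQuotient, G2, G2, if_pos hu, if_neg h, EReal.top_sub_coe, EReal.top_sub_coe]
  exact EReal.top_div_of_pos_ne_top (by exact_mod_cast (by positivity : 0 < t ^ 2 / 2))
    (EReal.coe_ne_top _)

lemma secondQuotient_nonneg (hu : u ∈ Uad Ω T α β) (hw : w ∈ subdifferential (G2 α β μ) u)
    (v : L2Cyl Ω T) {t : ℝ} (ht : 0 < t) : 0 ≤ secondQuotient (G2 α β μ) u w t v := by
  by_cases h : u + t • v ∈ Uad Ω T α β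
  · rw [secondQuotient_of_mem hu h]
    have := le_of_mem_subdifferential hu hw h
    exact_mod_cast div_nonneg (by linarith) (by positivity)
  · rw [secondQuotient_of_notMem hu ht h]
    exact le_top

lemma secondSubderivative_nonneg (hu : u ∈ Uad Ω T α β)
    (hw : w ∈ subdifferential (G2 α β μ) u) (v : L2Cyl Ω T) :
    0 ≤ secondSubderivative (G2 α β μ) u w v := by
  refine le_sInf ?_
  rintro _ ⟨t, h, ht, -, rfl⟩
  exact le_liminf_of_le (by isBoundedDefault)
    (Eventually.of_forall fun k => secondQuotient_nonneg hu hw _ (ht.1 k))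

/-- A bound below the second subderivative only has to be checked along feasible sequences whose
second-order quotients are all below a real constant. -/
lemma le_secondSubderivative (hu : u ∈ Uad Ω T α β) {v : L2Cyl Ω T} {L : EReal}
    (H : ∀ (c : ℝ) (t : ℕ → ℝ) (h : ℕ → L2Cyl Ω T), PosNull t → WeaklyTendsto h v →
      (∀ k, u + t k • h k ∈ Uad Ω T α β) →
      (∀ k, μ * j2 (u + t k • h k) - μ * j2 u - t k * inner ℝ w (h k) ≤ c * (t k ^ 2 / 2)) →
      L ≤ c) :
    L ≤ secondSubderivative (G2 α β μ) u w v := by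
  refine le_sInf ?_
  rintro _ ⟨t, h, ht, hh, rfl⟩
  by_contra! hlt
  obtain ⟨c, hc1, hc2⟩ := EReal.lt_iff_exists_real_btwn.1 hlt
  obtain ⟨φ, hφ, hφc⟩ := extraction_of_frequently_atTop (frequently_lt_of_liminf_lt
    (by isBoundedDefault) hc1)
  have hfeas : ∀ k, u + t (φ k) • h (φ k) ∈ Uad Ω T α β := by
    intro k
    by_contra hn
    have := hφc k
    rw [secondQuotient_of_notMem hu (ht.1 _) hn] at this
    exact not_top_lt this
  refine hc2.not_ge (H c (t ∘ φ) (h ∘ φ) (ht.comp hφ.tendsto_atTop) (hh.comp hφ.tendsto_atTop)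
    hfeas fun k => ?_)
  have := hφc k
  rw [secondQuotient_of_mem hu (hfeas k), EReal.coe_lt_coe_iff,
    div_lt_iff₀ (by have := ht.1 (φ k); positivity)] at this
  exact this.le

/-- Along sequences with bounded second-order quotients, the first-order terms have to balance in
the limit, so that the weak limit is a critical direction. -/
lemma critical_of_bounded (hΩ : Bornology.IsBounded Ω) (hμ : 0 < μ) (hu : u ∈ Uad Ω T α β)
    (hw : w ∈ subdifferential (G2 α β μ) u) {v : L2Cyl Ω T} {c : ℝ} {t : ℕ → ℝ}
    {h : ℕ → L2Cyl Ω T} (ht : PosNull t) (hh : WeaklyTendsto h v)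
    (hfeas : ∀ k, u + t k • h k ∈ Uad Ω T α β)
    (hc : ∀ k, μ * j2 (u + t k • h k) - μ * j2 u - t k * inner ℝ w (h k) ≤ c * (t k ^ 2 / 2)) :
    v ∈ tangentCone (Uad Ω T α β) u ∧ μ * dirDeriv j2 u v = inner ℝ w v := by
  have hvT : v ∈ tangentCone (Uad Ω T α β) u :=
    hh.mem_of_isClosed (convex_tangentCone convex_Uad hu) isClosed_closure
      (Eventually.of_forall fun k => mem_tangentCone_of_mem (ht.1 k) (hfeas k))
  refine ⟨hvT, le_antisymm ?_ (inner_le_dirDeriv hΩ hu hw hvT)⟩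
  have hr : Tendsto (fun k => (inner ℝ w (h k) + c / 2 * t k) / μ) atTop
      (𝓝 ((inner ℝ w v + c / 2 * 0) / μ)) := ((hh.inner w).add (ht.2.const_mul _)).div_const μ
  have := hh.le_of_convexOn (convexOn_dirDeriv (convexOn_j2 hΩ) u)
    (continuous_dirDeriv (convexOn_j2 hΩ) (abs_j2_sub_le hΩ) u) hr fun k => by
      have htk := ht.1 k
      refine (dirDeriv_le_slope (convexOn_j2 hΩ) u (h k) htk).trans ?_
      rw [div_le_div_iff₀ htk hμ]
      linarith [hc k]
  rw [le_div_iff₀ hμ] at this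
  linarith

lemma secondSubderivative_eq_top (hΩ : Bornology.IsBounded Ω) (hμ : 0 < μ)
    (hu : u ∈ Uad Ω T α β) (hw : w ∈ subdifferential (G2 α β μ) u) {v : L2Cyl Ω T}
    (hv : ¬(v ∈ tangentCone (Uad Ω T α β) u ∧ μ * dirDeriv j2 u v = inner ℝ w v)) :
    secondSubderivative (G2 α β μ) u w v = ⊤ :=
  top_le_iff.1 (le_secondSubderivative hu fun _ _ _ ht hh hfeas hc =>
    absurd (critical_of_bounded hΩ hμ hu hw ht hh hfeas hc) hv)

end Feasible


/-! ### Second-order expansion of `j₂` and the lower bound -/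

/-- Exact second-order expansion of the norm: the curvature term measures the part of `‖b‖²` that
is not spent on the change of the norm itself. -/
lemma norm_add_smul_sub_norm {Y : Type*} [NormedAddCommGroup Y] [InnerProductSpace ℝ Y] {a b : Y}
    {t : ℝ} (ha : 0 < ‖a‖) (ht : 0 < t) :
    ‖a + t • b‖ - ‖a‖ = t * (inner ℝ a b / ‖a‖)
      + t ^ 2 / 2 * ((‖b‖ ^ 2 - ((‖a + t • b‖ - ‖a‖) / t) ^ 2) / ‖a‖) := by
  have h : ‖a + t • b‖ ^ 2 = ‖a‖ ^ 2 + 2 * t * inner ℝ a b + t ^ 2 * ‖b‖ ^ 2 := by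
    rw [norm_add_sq_real, inner_smul_right, norm_smul, mul_pow, Real.norm_of_nonneg ht.le]
    ring
  field_simp
  linear_combination h

/-- Raising `absDirLp u v` to at least `-n|u|` is harmless in the limit: where `u = 0` the
directional derivative is nonnegative anyway. -/
lemma tendsto_absDirLp_sup {A : Type*} [MeasurableSpace A] {ν : Measure A} (u v : Lp ℝ 2 ν) :
    Tendsto (fun n : ℕ => absDirLp u v ⊔ -((n : ℝ) • |u|)) atTop (𝓝 (absDirLp u v)) := by
  have hco : ∀ n : ℕ, ∀ᵐ a ∂ν, (absDirLp u v ⊔ -((n : ℝ) • |u|)) a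
      = max (absDirLp u v a) (-(n * |u a|)) := fun n => by
    filter_upwards [Lp.coeFn_sup (absDirLp u v) (-((n : ℝ) • |u|)), Lp.coeFn_neg ((n : ℝ) • |u|),
      Lp.coeFn_smul (n : ℝ) |u|, Lp.coeFn_abs u] with a h1 h2 h3 h4
    rw [h1, Pi.sup_apply, h2, Pi.neg_apply, h3, Pi.smul_apply, h4]
    rfl
  refine L2_tendsto_of_dominated (b := |absDirLp u v|) (fun n => ?_) ?_
  · filter_upwards [hco n, Lp.coeFn_abs (absDirLp u v)] with a h1 h2
    rw [h1, h2]
    have : 0 ≤ n * |u a| := by positivity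
    rcases max_cases (absDirLp u v a) (-(n * |u a|)) with ⟨h, h'⟩ | ⟨h, h'⟩ <;> rw [h]
    · simp
    · rw [abs_of_pos (sub_pos.2 h'), abs_of_neg (h'.trans_le (neg_nonpos.2 this))]
      linarith
  · filter_upwards [ae_all_iff.2 hco, coeFn_absDirLp u v] with a h1 h2
    simp only [h1]
    refine tendsto_const_nhds.congr' ?_
    by_cases h0 : u a = 0
    · have : 0 ≤ absDirLp u v a := by simp [h2, h0, absDir]
      exact Eventually.of_forall fun n => (max_eq_left (by simpa [h0] using this)).symm
    · obtain ⟨N, hN⟩ := exists_nat_ge (-(absDirLp u v a) / |u a|)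
      filter_upwards [eventually_ge_atTop N] with n hn
      refine (max_eq_left ?_).symm
      have h3 := (div_le_iff₀ (abs_pos.2 h0)).1 (hN.trans (Nat.cast_le.2 hn))
      linarith

section SecondOrder

variable {d : ℕ} {Ω : Set (EuclideanSpace ℝ (Fin d))} {T α β μ : ℝ} {u w : L2Cyl Ω T}

lemma spaceIntegral_abs_add (hΩ : Bornology.IsBounded Ω) (u v : L2Cyl Ω T) {t : ℝ} (ht : 0 < t) :
    spaceIntegral hΩ |u + t • v|
      = spaceIntegral hΩ |u| + t • spaceIntegral hΩ (t⁻¹ • (|u + t • v| - |u|)) := by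
  rw [← map_smul, smul_smul, mul_inv_cancel₀ ht.ne', one_smul, map_sub]
  abel

lemma j2_add_smul_sub (hΩ : Bornology.IsBounded Ω) (hu0 : u ≠ 0) (v : L2Cyl Ω T) {t : ℝ}
    (ht : 0 < t) :
    j2 (u + t • v) - j2 u
      = t * (inner ℝ (spaceIntegral hΩ |u|)
          (spaceIntegral hΩ (t⁻¹ • (|u + t • v| - |u|))) / j2 u)
        + t ^ 2 / 2 * ((‖spaceIntegral hΩ (t⁻¹ • (|u + t • v| - |u|))‖ ^ 2
          - ((j2 (u + t • v) - j2 u) / t) ^ 2) / j2 u) := by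
  have hs := j2_pos hΩ hu0
  rw [j2_eq_norm hΩ (u + t • v), spaceIntegral_abs_add hΩ u v ht]
  rw [j2_eq_norm hΩ] at hs ⊢
  exact norm_add_smul_sub_norm hs ht

/-- The lower bound for the second subderivative at `u ≠ 0`. The difference quotients of
`t ↦ ∫_Ω |u(t)| dx` are tested with truncations of the expected limit, which become nonnegative
after adding a multiple of `∫_Ω |u(t)| dx`; against that multiple the quotients converge. -/
lemma le_of_bounded (hΩ : Bornology.IsBounded Ω) (hμ : 0 < μ) (hu : u ∈ Uad Ω T α β)
    (hu0 : u ≠ 0) (hw : w ∈ subdifferential (G2 α β μ) u) {v : L2Cyl Ω T} {c : ℝ} {t : ℕ → ℝ}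
    {h : ℕ → L2Cyl Ω T} (ht : PosNull t) (hh : WeaklyTendsto h v)
    (hfeas : ∀ k, u + t k • h k ∈ Uad Ω T α β)
    (hc : ∀ k, μ * j2 (u + t k • h k) - μ * j2 u - t k * inner ℝ w (h k) ≤ c * (t k ^ 2 / 2)) :
    μ / j2 u * (‖spaceIntegral hΩ (absDirLp u v)‖ ^ 2 - dirDeriv j2 u v ^ 2) ≤ c := by
  have hcrit := (critical_of_bounded hΩ hμ hu hw ht hh hfeas hc).2
  have hs := j2_pos hΩ hu0
  have hDj := dirDeriv_j2 hΩ hu0 v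
  have hDjk := fun k => dirDeriv_j2 hΩ hu0 (h k)
  have hexp := fun k => j2_add_smul_sub hΩ hu0 (h k) (ht.1 k)
  set P := spaceIntegral (T := T) hΩ
  set j' := dirDeriv j2 u v
  set s := j2 u
  set a := P |u|
  set b : ℕ → Lp ℝ 2 (volume.restrict (Ioo 0 T)) :=
    fun k => P ((t k)⁻¹ • (|u + t k • h k| - |u|)) with hb
  set σ : ℕ → ℝ := fun k => (j2 (u + t k • h k) - s) / t k with hσ
  have ha0 : 0 ≤ a := spaceIntegral_nonneg hΩ (abs_nonneg u)
  have hPb : ∀ k, P (absDirLp u (h k)) ≤ b k :=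
    fun k => spaceIntegral_mono hΩ (absDirLp_le_slope u (h k) (ht.1 k))
  have hσt : ∀ k, j2 (u + t k • h k) - s = t k * σ k := fun k => by
    have := (ht.1 k).ne'
    simp only [hσ]; field_simp
  -- the first-order part of the quotient is nonnegative
  have hlow : ∀ k, inner ℝ w (h k) ≤ μ * (inner ℝ a (b k) / s) := by
    intro k
    have h1 := inner_le_dirDeriv hΩ hu hw (mem_tangentCone_of_mem (ht.1 k) (hfeas k))
    have h2 : (inner ℝ a (P (absDirLp u (h k))) : ℝ) ≤ inner ℝ a (b k) := by
      rw [real_inner_comm, real_inner_comm (b k)]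
      exact L2_inner_le_inner_left (hPb k) ha0
    refine h1.trans (mul_le_mul_of_nonneg_left ?_ hμ.le)
    rw [hDjk k]
    gcongr
  have hexp' : ∀ k, σ k = inner ℝ a (b k) / s + t k / 2 * ((‖b k‖ ^ 2 - σ k ^ 2) / s) := by
    intro k
    have h1 : t k * σ k = t k * (inner ℝ a (b k) / s)
        + t k ^ 2 / 2 * ((‖b k‖ ^ 2 - σ k ^ 2) / s) := (hσt k).symm.trans (hexp k)
    exact mul_left_cancel₀ (ht.1 k).ne' (by rw [h1]; ring)
  have hc' : ∀ k, μ * σ k - inner ℝ w (h k) ≤ c / 2 * t k := by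
    intro k
    have h1 := hc k
    have h2 : μ * j2 (u + t k • h k) - μ * s = μ * (t k * σ k) := by rw [← hσt k]; ring
    rw [h2] at h1
    refine le_of_mul_le_mul_left ?_ (ht.1 k)
    linarith
  have hbd : ∀ k, ‖b k‖ ^ 2 ≤ c * s / μ + σ k ^ 2 := by
    intro k
    have h1 := hlow k
    have h2 : μ * (inner ℝ a (b k) / s) + t k / 2 * (μ * ((‖b k‖ ^ 2 - σ k ^ 2) / s))
        = μ * σ k := by
      conv_rhs => rw [hexp' k]
      ring
    have h3 : t k / 2 * (μ * ((‖b k‖ ^ 2 - σ k ^ 2) / s)) ≤ t k / 2 * c := by linarith [hc' k]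
    have h4 := le_of_mul_le_mul_left h3 (by linarith [ht.1 k])
    rw [← mul_div_assoc, div_le_iff₀ hs] at h4
    have h5 : ‖b k‖ ^ 2 - σ k ^ 2 ≤ c * s / μ := by
      rw [le_div_iff₀ hμ]; linarith
    linarith
  have hin := hh.inner w
  have hwj : inner ℝ w v / μ = j' := by rw [← hcrit]; field_simp
  have hσlim : Tendsto σ atTop (𝓝 j') := by
    have e1 : Tendsto (fun k => inner ℝ w (h k) / μ) atTop (𝓝 j') := by
      rw [← hwj]; exact hin.div_const μ
    have e2 : Tendsto (fun k => inner ℝ w (h k) / μ + c / 2 / μ * t k) atTop (𝓝 j') := by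
      simpa using e1.add (ht.2.const_mul (c / 2 / μ))
    refine tendsto_of_tendsto_of_tendsto_of_le_of_le e1 e2 (fun k => ?_) (fun k => ?_)
    · have := le_of_mem_subdifferential hu hw (hfeas k)
      rw [← mul_sub, hσt k, mul_left_comm] at this
      rw [div_le_iff₀ hμ, mul_comm]
      exact le_of_mul_le_mul_left this (ht.1 k)
    · have := hc' k
      have e : inner ℝ w (h k) / μ + c / 2 / μ * t k = (inner ℝ w (h k) + c / 2 * t k) / μ := by
        ring
      simp only [e]
      rw [le_div_iff₀ hμ]; linarith
  have hilim : Tendsto (fun k => (inner ℝ a (b k) : ℝ)) atTop (𝓝 (s * j')) := by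
    have e1 : Tendsto (fun k => s * (inner ℝ w (h k) / μ)) atTop (𝓝 (s * j')) := by
      rw [← hwj]; exact (hin.div_const μ).const_mul s
    have e2 : Tendsto (fun k => s * σ k + t k / 2 * σ k ^ 2) atTop (𝓝 (s * j')) := by
      simpa using (hσlim.const_mul s).add ((ht.2.div_const 2).mul (hσlim.pow 2))
    refine tendsto_of_tendsto_of_tendsto_of_le_of_le e1 e2 (fun k => ?_) (fun k => ?_)
    · have h1 : inner ℝ w (h k) / μ ≤ inner ℝ a (b k) / s := by
        rw [div_le_iff₀ hμ, mul_comm]; exact hlow k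
      have h2 := mul_le_mul_of_nonneg_left h1 hs.le
      rwa [mul_div_cancel₀ _ hs.ne'] at h2
    · have h1 : s * σ k = inner ℝ a (b k) + t k / 2 * (‖b k‖ ^ 2 - σ k ^ 2) := by
        conv_lhs => rw [hexp' k]
        field_simp
      have h2 : 0 ≤ t k / 2 * ‖b k‖ ^ 2 := by have := (ht.1 k).le; positivity
      show _ ≤ s * σ k + t k / 2 * σ k ^ 2
      rw [h1]; linarith
  have hDa : (inner ℝ (P (absDirLp u v)) a : ℝ) = s * j' := by
    rw [hDj, real_inner_comm]; field_simp
  -- weak compactness of `b` is avoided by `‖b k‖² ≥ 2 ⟨b k, e⟩ - ‖e‖²` for suitable `e`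
  have hM : ∀ n : ℕ, 2 * (inner ℝ (P (absDirLp u v)) (P (absDirLp u v ⊔ -((n : ℝ) • |u|))) : ℝ)
      - ‖P (absDirLp u v ⊔ -((n : ℝ) • |u|))‖ ^ 2 - j' ^ 2 ≤ c * s / μ := by
    intro n
    set e := absDirLp u v ⊔ -((n : ℝ) • |u|) with he
    have hψ : 0 ≤ P e + (n : ℝ) • a := by
      rw [← map_smul, ← map_add]
      refine spaceIntegral_nonneg hΩ ?_
      rw [← neg_le_iff_add_nonneg]
      exact le_sup_right
    set ψ := P e + (n : ℝ) • a with hψd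
    have hconv : ConvexOn ℝ univ (fun x : L2Cyl Ω T => (inner ℝ (P (absDirLp u x)) ψ : ℝ)) := by
      refine ⟨convex_univ, fun x _ y _ p q hp hq _ => ?_⟩
      have := L2_inner_le_inner_left
        (spaceIntegral_mono hΩ (absDirLp_convex u x y hp hq)) hψ
      rwa [map_add, map_smul, map_smul, inner_add_left, real_inner_smul_left,
        real_inner_smul_left] at this
    have hcont : Continuous (fun x : L2Cyl Ω T => (inner ℝ (P (absDirLp u x)) ψ : ℝ)) :=
      (P.continuous.comp (continuous_absDirLp u)).inner continuous_const
    have hr : Tendsto (fun k => (c * s / μ + σ k ^ 2 + ‖P e‖ ^ 2) / 2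
        + (n : ℝ) * inner ℝ a (b k)) atTop
        (𝓝 ((c * s / μ + j' ^ 2 + ‖P e‖ ^ 2) / 2 + (n : ℝ) * (s * j'))) :=
      ((((hσlim.pow 2).const_add _).add_const _).div_const 2).add (hilim.const_mul _)
    have hfin := hh.le_of_convexOn hconv hcont hr fun k => by
      refine (L2_inner_le_inner_left (hPb k) hψ).trans ?_
      have h1 : (inner ℝ (b k) ψ : ℝ) = inner ℝ (b k) (P e) + n * inner ℝ a (b k) := by
        rw [hψd, inner_add_right, real_inner_smul_right, real_inner_comm a]
      have h2 : 0 ≤ ‖b k - P e‖ ^ 2 := sq_nonneg _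
      rw [norm_sub_sq_real] at h2
      have h3 := hbd k
      rw [h1]; linarith
    simp only [hψd, inner_add_right, real_inner_smul_right, hDa] at hfin
    linarith
  have hPe : Tendsto (fun n : ℕ => P (absDirLp u v ⊔ -((n : ℝ) • |u|))) atTop
      (𝓝 (P (absDirLp u v))) := (P.continuous.tendsto _).comp (tendsto_absDirLp_sup u v)
  have hlim := le_of_tendsto ((((tendsto_const_nhds (x := P (absDirLp u v))).inner hPe).const_mul
    2).sub (hPe.norm.pow 2) |>.sub_const (j' ^ 2)) (Eventually.of_forall hM)
  rw [real_inner_self_eq_norm_sq, le_div_iff₀ hμ] at hlim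
  rw [div_mul_eq_mul_div, div_le_iff₀ hs]
  linarith

/-! ### Recovery sequences -/

/-- At `u ≠ 0` a critical direction `v` is recovered by restricting it to the sets on which the step
`t k` neither violates the constraints nor leaves the range where `|u + t k v| - |u|` equals
`t k` times the directional derivative. Restrictions of critical directions are critical since
`μ j₂'(u; ·) - w` is additive on disjoint supports and nonnegative on the tangent cone; hence the first-order terms cancel exactly. -/
lemma exists_recovery (hΩ : Bornology.IsBounded Ω) (hu : u ∈ Uad Ω T α β)
    (hu0 : u ≠ 0) (hw : w ∈ subdifferential (G2 α β μ) u) {v : L2Cyl Ω T}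
    (hvT : v ∈ tangentCone (Uad Ω T α β) u) (hcrit : μ * dirDeriv j2 u v = inner ℝ w v)
    {t : ℕ → ℝ} (ht : PosNull t) :
    ∃ h : ℕ → L2Cyl Ω T, Tendsto h atTop (𝓝 v) ∧
      Tendsto (fun k => secondQuotient (G2 α β μ) u w (t k) (h k)) atTop
        (𝓝 ((μ / j2 u * (‖spaceIntegral hΩ (absDirLp u v)‖ ^ 2 - dirDeriv j2 u v ^ 2) : ℝ)
          : EReal)) := by
  have hum : Measurable u := (Lp.stronglyMeasurable u).measurable
  have hvm : Measurable v := (Lp.stronglyMeasurable v).measurable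
  set E : ℕ → Set (EuclideanSpace ℝ (Fin d) × ℝ) := fun k =>
    {p | α ≤ u p + t k * v p} ∩ {p | u p + t k * v p ≤ β}
      ∩ {p | |u p + t k * v p| - |u p| = t k * absDir (u p) (v p)} with hEdef
  have hE : ∀ k, MeasurableSet (E k) := fun k =>
    ((measurableSet_le measurable_const (hum.add (hvm.const_mul _))).inter
      (measurableSet_le (hum.add (hvm.const_mul _)) measurable_const)).inter
      (measurableSet_eq_fun ((hum.add (hvm.const_mul _)).abs.sub hum.abs)
        ((measurable_absDir.comp (hum.prodMk hvm)).const_mul _))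
  have hEev : ∀ᵐ p ∂(cylinderMeasure Ω T), ∀ᶠ k in atTop, p ∈ E k := by
    filter_upwards [hu, sign_of_mem_tangentCone hvT] with p h1 h2
    have hlim : Tendsto (fun k => u p + t k * v p) atTop (𝓝 (u p)) := by
      simpa using tendsto_const_nhds.add (ht.2.mul_const (v p))
    have hA : ∀ᶠ k in atTop, α ≤ u p + t k * v p := by
      rcases h1.1.eq_or_lt with h | h
      · refine Eventually.of_forall fun k => ?_
        have := mul_nonneg (ht.1 k).le (h2.1 h.symm)
        linarith
      · exact (hlim.eventually_const_lt h).mono fun _ => le_of_lt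
    have hB : ∀ᶠ k in atTop, u p + t k * v p ≤ β := by
      rcases h1.2.eq_or_lt with h | h
      · refine Eventually.of_forall fun k => ?_
        have := mul_nonpos_of_nonneg_of_nonpos (ht.1 k).le (h2.2 h)
        linarith
      · exact (hlim.eventually_lt_const h).mono fun _ => le_of_lt
    filter_upwards [hA, hB, ht.tendsto_nhdsGT.eventually (eventually_abs_add_mul (u p) (v p))]
      with k h3 h4 h5
    exact ⟨⟨h3, h4⟩, h5⟩
  set h : ℕ → L2Cyl Ω T := fun k => cutoff (E k) (hE k) v with hh
  have hlim : Tendsto h atTop (𝓝 v) := by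
    refine L2_tendsto_of_dominated (b := |v|) (fun k => ?_) ?_
    · filter_upwards [coeFn_cutoff (E k) (hE k) v, Lp.coeFn_abs v] with p h1 h2
      rw [h1, h2]
      by_cases hp : p ∈ E k <;> simp [hp]
    · filter_upwards [ae_all_iff.2 fun k => coeFn_cutoff (E k) (hE k) v, hEev] with p h1 h2
      refine tendsto_const_nhds.congr' ?_
      filter_upwards [h2] with k hk
      rw [hh, h1 k, Set.indicator_of_mem hk]
  have hfeas : ∀ k, u + t k • h k ∈ Uad Ω T α β := by
    intro k
    rw [mem_Uad_add_smul]
    filter_upwards [hu, coeFn_cutoff (E k) (hE k) v] with p h1 h2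
    rw [hh, h2]
    by_cases hp : p ∈ E k
    · rw [Set.indicator_of_mem hp]
      exact hp.1
    · simpa [Set.indicator_of_notMem hp] using h1
  have hslope : ∀ k, (t k)⁻¹ • (|u + t k • h k| - |u|) = absDirLp u (h k) := by
    intro k
    refine slope_eq_absDirLp u (h k) (ht.1 k) ?_
    filter_upwards [coeFn_cutoff (E k) (hE k) v] with p h2
    rw [hh, h2]
    by_cases hp : p ∈ E k
    · rw [Set.indicator_of_mem hp]
      exact hp.2
    · simp [Set.indicator_of_notMem hp, absDir_zero_right]
  have hcritk : ∀ k, μ * dirDeriv j2 u (h k) = inner ℝ w (h k) := by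
    intro k
    have h1 := inner_le_dirDeriv hΩ hu hw (cutoff_mem_tangentCone hu (E k) (hE k) hvT)
    have h2 := inner_le_dirDeriv hΩ hu hw (cutoff_mem_tangentCone hu (E k)ᶜ (hE k).compl hvT)
    have h3 : (inner ℝ w v : ℝ) = inner ℝ w (h k) + inner ℝ w (cutoff (E k)ᶜ (hE k).compl v) := by
      rw [← inner_add_right, hh, cutoff_add_compl]
    have h4 : dirDeriv j2 u v
        = dirDeriv j2 u (h k) + dirDeriv j2 u (cutoff (E k)ᶜ (hE k).compl v) := by
      rw [dirDeriv_j2 hΩ hu0, dirDeriv_j2 hΩ hu0, dirDeriv_j2 hΩ hu0, ← add_div,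
        ← inner_add_right, ← map_add, hh, absDirLp_cutoff_add_compl]
    rw [h3, h4, mul_add] at hcrit
    exact le_antisymm (by linarith) h1
  refine ⟨h, hlim, ?_⟩
  have hs := j2_pos hΩ hu0
  -- the first-order terms cancel, so only the curvature of the norm remains
  have hq : ∀ k, secondQuotient (G2 α β μ) u w (t k) (h k)
      = ((μ / j2 u * (‖spaceIntegral hΩ (absDirLp u (h k))‖ ^ 2
        - ((j2 (u + t k • h k) - j2 u) / t k) ^ 2) : ℝ) : EReal) := by
    intro k
    have htk := ht.1 k
    rw [secondQuotient_of_mem hu (hfeas k), EReal.coe_eq_coe_iff, div_eq_iff (by positivity)]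
    have h1 := j2_add_smul_sub hΩ hu0 (h k) htk
    rw [hslope, ← dirDeriv_j2 hΩ hu0] at h1
    rw [← hcritk k]
    linear_combination μ * h1
  have hbt : Tendsto (fun k => spaceIntegral hΩ (absDirLp u (h k))) atTop
      (𝓝 (spaceIntegral hΩ (absDirLp u v))) :=
    (((spaceIntegral hΩ).continuous.comp (continuous_absDirLp u)).tendsto v).comp hlim
  have hσlim : Tendsto (fun k => (j2 (u + t k • h k) - j2 u) / t k) atTop
      (𝓝 (dirDeriv j2 u v)) := by
    have h1 := (tendsto_slope_dirDeriv (convexOn_j2 hΩ) u v).comp ht.tendsto_nhdsGT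
    have h2 : Tendsto (fun k => ‖spaceIntegral (T := T) hΩ‖ * ‖h k - v‖) atTop (𝓝 0) := by
      simpa using (tendsto_iff_norm_sub_tendsto_zero.1 hlim).const_mul ‖spaceIntegral (T := T) hΩ‖
    have h3 : Tendsto (fun k => (j2 (u + t k • h k) - j2 u) / t k
        - (j2 (u + t k • v) - j2 u) / t k) atTop (𝓝 0) := by
      refine squeeze_zero_norm (fun k => ?_) h2
      have htk := ht.1 k
      rw [← sub_div, sub_sub_sub_cancel_right, Real.norm_eq_abs, abs_div, abs_of_pos htk,
        div_le_iff₀ htk]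
      refine (abs_j2_sub_le hΩ _ _).trans_eq ?_
      rw [add_sub_add_left_eq_sub, ← smul_sub, norm_smul, Real.norm_of_nonneg htk.le]
      ring
    simpa using h3.add h1
  simp only [hq]
  exact (continuous_coe_real_ereal.tendsto _).comp
    (((hbt.norm.pow 2).sub (hσlim.pow 2)).const_mul _)

lemma secondSubderivative_le_of_tendsto {G : L2Cyl Ω T → EReal} {v : L2Cyl Ω T} {t : ℕ → ℝ}
    {h : ℕ → L2Cyl Ω T} {L : EReal} (ht : PosNull t) (hh : Tendsto h atTop (𝓝 v))
    (hL : Tendsto (fun k => secondQuotient G u w (t k) (h k)) atTop (𝓝 L)) :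
    secondSubderivative G u w v ≤ L :=
  sInf_le ⟨t, h, ht, WeaklyTendsto.of_tendsto hh, hL.liminf_eq.symm⟩

lemma tendsto_top_of_secondSubderivative_eq_top {G : L2Cyl Ω T → EReal} {v : L2Cyl Ω T}
    {t : ℕ → ℝ} (ht : PosNull t) (hv : secondSubderivative G u w v = ⊤) :
    Tendsto (fun k => secondQuotient G u w (t k) v) atTop (𝓝 ⊤) := by
  have h1 : secondSubderivative G u w v ≤ liminf (fun k => secondQuotient G u w (t k) v) atTop :=
    sInf_le ⟨t, fun _ => v, ht, WeaklyTendsto.of_tendsto tendsto_const_nhds, rfl⟩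
  rw [hv] at h1
  exact tendsto_of_le_liminf_of_limsup_le h1 le_top

end SecondOrder

end

end SparseControl

open SparseControl
theorem theoremG2 {d : ℕ} (Ω : Set (EuclideanSpace ℝ (Fin d))) (hΩo : IsOpen Ω)
    (hΩb : Bornology.IsBounded Ω) (hΩn : Ω.Nonempty) (T : ℝ) (hT : 0 < T)
    (α β μ : ℝ) (hα : α < 0) (hβ : 0 < β) (hμ : 0 < μ)
    (F : L2Cyl Ω T → ℝ) (u : L2Cyl Ω T) (hu : u ∈ Uad Ω T α β)
    (F₁ : L2Cyl Ω T) (F₂ : L2Cyl Ω T →L[ℝ] L2Cyl Ω T →L[ℝ] ℝ)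
    (hF : HasSecondOrderExpansion F (Uad Ω T α β) u F₁ F₂)
    (hsub : -F₁ ∈ subdifferential (G2 (Ω := Ω) (T := T) α β μ) u) :
    (u ≠ 0 →
      (∀ v ∈ criticalCone α β μ u F₁,
        secondSubderivative (G2 α β μ) u (-F₁) v =
          ((μ / j2 u * ((∫ t in Ioo 0 T, dirDeriv (jOmega Ω) (slice u t) (slice v t) ^ 2)
            - dirDeriv j2 u v ^ 2) : ℝ) : EReal)) ∧
      StronglyTwiceEpiDifferentiable (G2 α β μ) u (-F₁)) ∧
    (u = 0 →
      (∀ v ∈ criticalCone α β μ u F₁, 0 ≤ secondSubderivative (G2 α β μ) u (-F₁) v) ∧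
      (∀ v ∉ criticalCone α β μ u F₁, secondSubderivative (G2 α β μ) u (-F₁) v = ⊤)) := by
  have hcone : ∀ v, v ∈ criticalCone α β μ u F₁ ↔
      v ∈ tangentCone (Uad Ω T α β) u ∧ μ * dirDeriv j2 u v = inner ℝ (-F₁) v := fun v => by
    refine and_congr_right fun _ => ?_
    rw [inner_neg_left]
    constructor <;> intro h <;> linarith
  have htop : ∀ v ∉ criticalCone α β μ u F₁, secondSubderivative (G2 α β μ) u (-F₁) v = ⊤ :=
    fun v hv => secondSubderivative_eq_top hΩb hμ hu hsub fun h => hv ((hcone v).2 h)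
  refine ⟨fun hu0 => ?_, fun _ => ⟨fun v _ => secondSubderivative_nonneg hu hsub v, htop⟩⟩
  have hval : ∀ v ∈ criticalCone α β μ u F₁, secondSubderivative (G2 α β μ) u (-F₁) v
      = ((μ / j2 u * (‖spaceIntegral hΩb (absDirLp u v)‖ ^ 2 - dirDeriv j2 u v ^ 2) : ℝ)
        : EReal) := by
    intro v hv
    obtain ⟨hvT, hcrit⟩ := (hcone v).1 hv
    refine le_antisymm ?_ (le_secondSubderivative hu fun c t h ht hh hfeas hc =>
      EReal.coe_le_coe_iff.2 (le_of_bounded hΩb hμ hu hu0 hsub ht hh hfeas hc))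
    have ht : PosNull fun n : ℕ => 1 / ((n : ℝ) + 1) :=
      ⟨fun n => by positivity, tendsto_one_div_add_atTop_nhds_zero_nat⟩
    obtain ⟨h, hh, hL⟩ := exists_recovery hΩb hu hu0 hsub hvT hcrit ht
    exact secondSubderivative_le_of_tendsto ht hh hL
  refine ⟨fun v hv => ?_, fun v t ht => ?_⟩
  · rw [hval v hv, integral_dirDeriv_sq hΩb]
  · by_cases hv : v ∈ criticalCone α β μ u F₁
    · rw [hval v hv]
      obtain ⟨hvT, hcrit⟩ := (hcone v).1 hv
      exact exists_recovery hΩb hu hu0 hsub hvT hcrit ht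
    · refine ⟨fun _ => v, tendsto_const_nhds, ?_⟩
      rw [htop v hv]
      exact tendsto_top_of_secondSubderivative_eq_top ht (htop v hv)
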